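/- **Setting.** A splitting problem is $$\min_{x\in\mathbb R^d,\;y\in\mathbb R^{\bar n}} F(x,y):=f_0(x)+\bar g(y)\quad\text{s.t. } Ax+b=0,\ \ y=\bar Ax+\bar b,\tag{SP}$$ with $A\in\mathbb R^{n\times d}$, $\bar A\in\mathbb R^{\bar n\times d}$. For $\epsilon\ge 0$, a point $(x,y)$ is an *$\epsilon$-stationary point* of (SP) if for some $z_1\in\mathbb R^{\bar n}$, $z_2\in\mathbb R^n$ $$\max\{\operatorname{dist}(0,\partial\bar g(y)-z_1),\ \|\nabla f_0(x)+\bar A^\top z_1+A^\top z_2\|,\ \|y-\bar Ax-\bar b\|,\ \|Ax+b\|\}\le\epsilon .$$ A sequence $\{(x^{(t)},y^{(t)})\}_{t\ge0}$ (the $t$-th iteration being one oracle call) satisfies the *linear-span assumption* if for all $t\ge1$ $$x^{(t)}\in\operatorname{span}\Big(\{A^\top b,\bar A^\top\bar b\}\cup\bigcup_{s<t}\{x^{(s)},\nabla f_0(x^{(s)}),A^\top Ax^{(s)},\bar A^\top\bar Ax^{(s)},\bar A^\top y^{(s)}\}\Big)$$ and $y^{(t)}\in\operatorname{span}\{\xi^{(t)},\zeta^{(t)}\}$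 for some $$\xi^{(t)}\in\operatorname{span}\Big(\{\bar b\}\cup\bigcup_{s<t}\{y^{(s)},\bar A\bar A^\top y^{(s)},\bar Ax^{(s)}\}\Big),\qquad \zeta^{(t)}=\operatorname{prox}_{\eta\bar g}(\xi^{(t)})\ \text{ with some } \eta>0,$$ where $\operatorname{prox}_{\eta\bar g}(\xi)=\arg\min_u\{\bar g(u)+\tfrac1{2\eta}\|u-\xi\|^2\}$. Put $\Delta_F=F(x^{(0)},y^{(0)})-\inf_{x,y}F(x,y)$, and $\kappa(M)=\sqrt{\lambda_{\max}(MM^\top)/\lambda_{\min}(MM^\top)}$ for a matrix $M$; $[\bar A;A]$ is $\bar A$ stacked on $A$. **The instance $\mathcal P$ with accuracy parameter $\delta>0$.** Let $L_f>0$, let $m_1\ge2$, $m_2\ge1$ be integers with $m_1m_2$ even, $m=3m_1m_2$, and let $\bar d\ge5$ be odd. Write $x=(x_1,\dots,x_m)$ with $x_i\in\mathbb R^{\bar d}$. Let $J_m\in\mathbb R^{(m-1)\times m}$ have as $i$-th row $e_{i+1}^\top-e_i^\top$, let $\mathcal M=\{lm_1:l=1,\dots,3m_2-1\}$ and $\mathcal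 M^C=\{1,\dots,m-1\}\setminus\mathcal M$, and let $J_{\mathcal M}$, $J_{\mathcal M^C}$ consist of the rows of $J_m$ with index in $\mathcal M$, $\mathcal M^C$. Put $$\bar A=mL_f\,J_{\mathcal M}\otimes I_{\bar d},\quad A=mL_f\,J_{\mathcal M^C}\otimes I_{\bar d},\quad b=0,\ \bar b=0,\quad \bar g(y)=\tfrac{\beta}{mL_f}\|y\|_1,$$ with $\beta>(50\pi+1+\|A\|)\sqrt m\,\delta$ ($\|A\|$ the spectral norm). Let $\Psi(u)=0$ for $u\le0$, $\Psi(u)=1-e^{-u^2}$ for $u>0$, and $\Phi(v)=4\arctan v+2\pi$; for $z\in\mathbb R^{\bar d}$ let $\varphi(z,1)=-\Psi(1)\Phi([z]_1)$ and $\varphi(z,j)=\Psi(-[z]_{j-1})\Phi(-[z]_j)-\Psi([z]_{j-1})\Phi([z]_j)$ for $2\le j\le\bar d$. Let $h_i(z)$ be $\varphi(z,1)+3\sum_{j=1}^{\lfloor\bar d/2\rfloor}\varphi(z,2j)$ for $1\le i\le\frac m3$, $\varphi(z,1)$ for $\frac m3<i\le\frac{2m}3$, and $\varphi(z,1)+3\sum_{j=1}^{\lfloor\bar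 d/2\rfloor}\varphi(z,2j+1)$ for $\frac{2m}3<i\le m$, and let $$f_i(z)=\frac{300\pi\delta^2}{mL_f}\,h_i\!\Big(\frac{\sqrt m\,L_f\,z}{150\pi\delta}\Big),\qquad f_0(x)=\sum_{i=1}^m f_i(x_i).$$ **Theorem.** Let $\epsilon>0$ and $L_f>0$. Let $\mathcal P$ be any instance as above whose accuracy parameter satisfies $\epsilon\le\delta\le2\epsilon$ (for instance $\delta=\epsilon$). Then $f_0$ is differentiable with $L_f$-Lipschitz gradient, $\bar g$ is (finite, hence proper) convex and lower semicontinuous, and $\inf_{x,y}F(x,y)>-\infty$. Moreover, for every sequence $\{(x^{(t)},y^{(t)})\}_{t\ge0}$ with $(x^{(0)},y^{(0)})=(0,0)$ that satisfies the linear-span assumption for (SP) with the data of $\mathcal P$: if $(x^{(t)},y^{(t)})$ is an $\epsilon$-stationary point of (SP), then $$t\ \ge\ \left\lceil\frac{\kappa([\bar A;A])\,L_f\,\Delta_F}{72000\,\pi^2}\,\epsilon^{-2}\right\rceil .$$ That is, every algorithm of this class, started at the origin, needs at least that many oracle calls to obtain an $\epsilon$-stationary point of the instance. -/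

import Mathlib

open scoped Kronecker

noncomputable section

/-- The product `M v` of a real matrix with a vector of a Euclidean space. -/
def Matrix.mulE {ρ σ : Type*} [Fintype σ] (M : Matrix ρ σ ℝ) (v : EuclideanSpace ℝ σ) :
    EuclideanSpace ℝ ρ :=
  WithLp.toLp 2 (M.mulVec (WithLp.ofLp v))

/-- The spectral norm of a real matrix (operator norm for the Euclidean norms). -/
def Matrix.specNorm {ρ σ : Type*} [Fintype ρ] [Fintype σ] [DecidableEq σ]
    (M : Matrix ρ σ ℝ) : ℝ :=
  ‖(Matrix.toEuclideanLin M).toContinuousLinearMap‖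

/-- `κ(M) = √(λ_max(M Mᵀ) / λ_min(M Mᵀ))`. -/
def Matrix.condNumber {ρ σ : Type*} [Fintype ρ] [DecidableEq ρ] [Fintype σ]
    (M : Matrix ρ σ ℝ) : ℝ :=
  √(sSup (spectrum ℝ (M * M.transpose)) / sInf (spectrum ℝ (M * M.transpose)))

/-- The subdifferential of a (finite) convex function at a point. -/
def convexSubdiff {E : Type*} [NormedAddCommGroup E] [InnerProductSpace ℝ E]
    (g : E → ℝ) (y : E) : Set E :=
  {v | ∀ u, g y + inner ℝ v (u - y) ≤ g u}

/-- `p = prox_{η g}(ξ)`, i.e. `p` minimizes `u ↦ g u + ‖u - ξ‖² / (2 η)`. -/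
def IsProx {E : Type*} [NormedAddCommGroup E] (g : E → ℝ) (η : ℝ) (ξ p : E) : Prop :=
  ∀ u, g p + 1 / (2 * η) * ‖p - ξ‖ ^ 2 ≤ g u + 1 / (2 * η) * ‖u - ξ‖ ^ 2

/-- The data of a splitting problem
`min F(x, y) = f₀ x + ḡ y` subject to `A x + b = 0`, `y = Ā x + b̄`,
where the coordinates of `x`, of `y` and of `A x` are indexed by `ι`, `κ` and `ν`.
The function `ḡ` is finite everywhere, hence proper. -/
structure SplitProblem (ι κ ν : Type*) where
  f₀ : EuclideanSpace ℝ ι → ℝ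
  gbar : EuclideanSpace ℝ κ → ℝ
  A : Matrix ν ι ℝ
  b : EuclideanSpace ℝ ν
  Abar : Matrix κ ι ℝ
  bbar : EuclideanSpace ℝ κ

namespace SplitProblem

variable {ι κ ν : Type*} [Fintype ι] [Fintype κ] [Fintype ν]

/-- The objective function `F(x, y) = f₀ x + ḡ y`. -/
def F (P : SplitProblem ι κ ν) (x : EuclideanSpace ℝ ι) (y : EuclideanSpace ℝ κ) : ℝ :=
  P.f₀ x + P.gbar y

/-- `Δ_F = F(x⁰, y⁰) - inf F`; the infimum is over all `(x, y)`, feasible or not. -/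
def gap (P : SplitProblem ι κ ν) (x₀ : EuclideanSpace ℝ ι) (y₀ : EuclideanSpace ℝ κ) : ℝ :=
  P.F x₀ y₀ - ⨅ p : EuclideanSpace ℝ ι × EuclideanSpace ℝ κ, P.F p.1 p.2

/-- The joint condition number `κ([Ā; A])`. -/
def jointCond [DecidableEq κ] [DecidableEq ν] (P : SplitProblem ι κ ν) : ℝ :=
  (Matrix.fromRows P.Abar P.A).condNumber

/-- The standing assumptions: `f₀` is differentiable with `L`-Lipschitz gradient, `ḡ` is convex and
lower semicontinuous, and `F` is bounded below. -/
def Admissible (P : SplitProblem ι κ ν) (L : ℝ) : Prop :=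
  Differentiable ℝ P.f₀ ∧
  (∀ x x', ‖gradient P.f₀ x - gradient P.f₀ x'‖ ≤ L * ‖x - x'‖) ∧
  ConvexOn ℝ Set.univ P.gbar ∧
  LowerSemicontinuous P.gbar ∧
  BddBelow (Set.range fun p : EuclideanSpace ℝ ι × EuclideanSpace ℝ κ => P.F p.1 p.2)

/-- `(x, y)` is an `ε`-stationary point of the splitting problem. The first inequality says
`dist(0, ∂ḡ(y) - z₁) ≤ ε`, with the convention that the distance to the empty set is `∞`. -/
def IsStationary (P : SplitProblem ι κ ν) (ε : ℝ)
    (x : EuclideanSpace ℝ ι) (y : EuclideanSpace ℝ κ) : Prop :=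
  ∃ (z₁ : EuclideanSpace ℝ κ) (z₂ : EuclideanSpace ℝ ν),
    Metric.infEDist 0 ((fun v => v - z₁) '' convexSubdiff P.gbar y) ≤ ENNReal.ofReal ε ∧
    ‖gradient P.f₀ x + P.Abar.transpose.mulE z₁ + P.A.transpose.mulE z₂‖ ≤ ε ∧
    ‖y - P.Abar.mulE x - P.bbar‖ ≤ ε ∧
    ‖P.A.mulE x + P.b‖ ≤ ε

/-- The linear-span assumption on the iterates `(x t, y t)`, `t = 0, 1, 2, …`, of an algorithm for
the splitting problem; the `t`-th iteration is one oracle call. -/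
def LinearSpan (P : SplitProblem ι κ ν)
    (x : ℕ → EuclideanSpace ℝ ι) (y : ℕ → EuclideanSpace ℝ κ) : Prop :=
  ∀ t, 1 ≤ t →
    x t ∈ Submodule.span ℝ
      ({P.A.transpose.mulE P.b, P.Abar.transpose.mulE P.bbar} ∪
        ⋃ s ∈ Set.Iio t,
          {x s, gradient P.f₀ (x s), P.A.transpose.mulE (P.A.mulE (x s)),
            P.Abar.transpose.mulE (P.Abar.mulE (x s)), P.Abar.transpose.mulE (y s)}) ∧
    ∃ ξ ζ : EuclideanSpace ℝ κ,
      ξ ∈ Submodule.span ℝ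
        ({P.bbar} ∪
          ⋃ s ∈ Set.Iio t,
            {y s, P.Abar.mulE (P.Abar.transpose.mulE (y s)), P.Abar.mulE (x s)}) ∧
      (∃ η : ℝ, 0 < η ∧ IsProx P.gbar η ξ ζ) ∧
      y t ∈ Submodule.span ℝ {ξ, ζ}

end SplitProblem

namespace HardInstance

/-- The difference matrix `J_p`, whose `k`-th row is `e_{k+1} - e_k`. -/
def J (p : ℕ) : Matrix (Fin (p - 1)) (Fin p) ℝ :=
  Matrix.of fun k j =>
    if (j : ℕ) = k then -1 else if (j : ℕ) = k + 1 then 1 else 0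

/-- The number of blocks, `m = 3 m₁ m₂`. -/
abbrev m (m₁ m₂ : ℕ) : ℕ := 3 * m₁ * m₂

/-- The index set `ℳ = {l m₁ : l = 1, …, 3 m₂ - 1}` as a set of rows of `J_m`. Rows are numbered
from `0` in `Fin (m - 1)`, so that the row `k` has the number `k + 1` when one counts from `1`. -/
def rowsM (m₁ m₂ : ℕ) : Finset (Fin (m m₁ m₂ - 1)) :=
  Finset.univ.filter fun k => (k : ℕ) + 1 ∈ (Finset.Icc 1 (3 * m₂ - 1)).image (· * m₁)

/-- `A = m L_f · J_{ℳᶜ} ⊗ I`. -/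
def A (Lf : ℝ) (m₁ m₂ dbar : ℕ) :
    Matrix ({k // k ∈ (rowsM m₁ m₂)ᶜ} × Fin dbar) (Fin (m m₁ m₂) × Fin dbar) ℝ :=
  ((m m₁ m₂ : ℝ) * Lf) •
    ((J (m m₁ m₂)).submatrix Subtype.val id ⊗ₖ (1 : Matrix (Fin dbar) (Fin dbar) ℝ))

/-- `Ā = m L_f · J_ℳ ⊗ I`. -/
def Abar (Lf : ℝ) (m₁ m₂ dbar : ℕ) :
    Matrix ({k // k ∈ rowsM m₁ m₂} × Fin dbar) (Fin (m m₁ m₂) × Fin dbar) ℝ :=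
  ((m m₁ m₂ : ℝ) * Lf) •
    ((J (m m₁ m₂)).submatrix Subtype.val id ⊗ₖ (1 : Matrix (Fin dbar) (Fin dbar) ℝ))

def Psi (u : ℝ) : ℝ := if u ≤ 0 then 0 else 1 - Real.exp (-u ^ 2)

def Phi (v : ℝ) : ℝ := 4 * Real.arctan v + 2 * Real.pi

/-- The coordinate `[z]_j` of `z ∈ ℝ^dbar`, `j` counted from `1` to `dbar` (`0` for other `j`). -/
def coord {dbar : ℕ} (z : Fin dbar → ℝ) (j : ℕ) : ℝ :=
  if h : 1 ≤ j ∧ j ≤ dbar then z ⟨j - 1, by omega⟩ else 0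

/-- `φ(z, j)` for `j = 1, …, dbar`. -/
def phi {dbar : ℕ} (z : Fin dbar → ℝ) (j : ℕ) : ℝ :=
  if j = 1 then -Psi 1 * Phi (coord z 1)
  else Psi (-coord z (j - 1)) * Phi (-coord z j) - Psi (coord z (j - 1)) * Phi (coord z j)

/-- The function `h_i`, with `i` counted from `1` to `m = 3 m₁ m₂`. -/
def h (m₁ m₂ : ℕ) {dbar : ℕ} (i : ℕ) (z : Fin dbar → ℝ) : ℝ :=
  if i ≤ m₁ * m₂ then
    phi z 1 + 3 * ∑ j ∈ Finset.Icc 1 (dbar / 2), phi z (2 * j)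
  else if i ≤ 2 * (m₁ * m₂) then
    phi z 1
  else
    phi z 1 + 3 * ∑ j ∈ Finset.Icc 1 (dbar / 2), phi z (2 * j + 1)

/-- The function `f_i`, with `i` counted from `1` to `m`. -/
def f (ε Lf : ℝ) (m₁ m₂ : ℕ) {dbar : ℕ} (i : ℕ) (z : Fin dbar → ℝ) : ℝ :=
  300 * Real.pi * ε ^ 2 / ((m m₁ m₂ : ℝ) * Lf) *
    h m₁ m₂ i ((√(m m₁ m₂ : ℝ) * Lf / (150 * Real.pi * ε)) • z)

/-- `f₀(x) = ∑_i f_i(x_i)`, where `x_i` is the `i`-th block of `x`. -/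
def f₀ (ε Lf : ℝ) (m₁ m₂ dbar : ℕ) (x : EuclideanSpace ℝ (Fin (m m₁ m₂) × Fin dbar)) : ℝ :=
  ∑ i : Fin (m m₁ m₂), f ε Lf m₁ m₂ ((i : ℕ) + 1) (fun j => x (i, j))

/-- `ḡ(y) = β / (m L_f) · ‖y‖₁`. -/
def gbar (Lf β : ℝ) (m₁ m₂ dbar : ℕ)
    (y : EuclideanSpace ℝ ({k // k ∈ rowsM m₁ m₂} × Fin dbar)) : ℝ :=
  β / ((m m₁ m₂ : ℝ) * Lf) * ∑ k, |y k|

/-- The splitting reformulation of the hard instance `𝒫` with accuracy parameter `ε`. -/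
def problem (ε Lf β : ℝ) (m₁ m₂ dbar : ℕ) :
    SplitProblem (Fin (m m₁ m₂) × Fin dbar) ({k // k ∈ rowsM m₁ m₂} × Fin dbar)
      ({k // k ∈ (rowsM m₁ m₂)ᶜ} × Fin dbar) where
  f₀ := f₀ ε Lf m₁ m₂ dbar
  gbar := gbar Lf β m₁ m₂ dbar
  A := A Lf m₁ m₂ dbar
  b := 0
  Abar := Abar Lf m₁ m₂ dbar
  bbar := 0

/-- The conditions on the parameters of the hard instance `𝒫` with accuracy parameter `ε`. -/
def Params (ε Lf β : ℝ) (m₁ m₂ dbar : ℕ) : Prop :=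
  2 ≤ m₁ ∧ 1 ≤ m₂ ∧ Even (m₁ * m₂) ∧ 5 ≤ dbar ∧ Odd dbar ∧
  (50 * Real.pi + 1 + (A Lf m₁ m₂ dbar).specNorm) * √(m m₁ m₂ : ℝ) * ε < β

end HardInstance

end

/-! Write `N = m₁ * m₂`, so that there are `3N` blocks. Up to scaling, each `f_i` is a weighted sum
of functions `link u v` of consecutive coordinates of its block, the chain being started by a fixed
entry `1`. Both partial derivatives of `link` vanish at `u = 0`, so the gradient cannot switch on a
coordinate while it and its predecessor are zero. Apart from the initial link, which all blocks
share, the links leaving odd positions (counted from 1) live in the first third of the blocks, those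
leaving even positions in the last third, and the middle third has none. `A` and `Ā` couple only
neighbouring blocks, and the prox of a multiple of the ℓ¹ norm creates no new nonzero entry. Hence
news about a coordinate crosses the middle third at one block per oracle call before the next
coordinate can be switched on, and the last coordinate of the first block stays zero before call
`(dbar - 1) * N` (`linearSpan_mem`).

On the other hand an ε-stationary point has no zero coordinate in its first block
(`ne_zero_of_isStationary`). Since `β` exceeds every possible multiplier, `y = 0`; near-feasibility
then makes all blocks almost equal. If a coordinate vanished, take the first chain index at which
the scaled first block drops below `1` in absolute value. The partial derivatives there have the
same sign in all blocks and cannot cancel, and their sum is at least `(3/2)√m δ` in absolute value.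
Testing with a vector constant across the blocks, which `A` and `Ā` annihilate, bounds that sum by
`√m ε`, a contradiction.

It remains to compare constants: `Δ_F ≤ 1800π²δ² dbar / L_f` and `κ ≤ 2m = 6N`, so with `δ ≤ 2ε` the
claimed bound is at most `0.6 N dbar ≤ (dbar - 1) N`. -/

namespace HardInstance

/-! ### Scalar building blocks: derivatives, bounds and Lipschitz constants -/

/-- The derivative of `Psi`. -/
noncomputable def dPsi (u : ℝ) : ℝ := 2 * max u 0 * Real.exp (-(max u 0) ^ 2)

/-- The derivative of `Phi`. -/
noncomputable def dPhi (v : ℝ) : ℝ := 4 / (1 + v ^ 2)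

/-- The two-variable function of which every `phi` is a specialization. -/
noncomputable def link (u v : ℝ) : ℝ := Psi (-u) * Phi (-v) - Psi u * Phi v

/-- The negative of the first partial derivative of `link`. -/
noncomputable def linkFst (u v : ℝ) : ℝ := dPsi (-u) * Phi (-v) + dPsi u * Phi v

/-- The negative of the second partial derivative of `link`. -/
noncomputable def linkSnd (u v : ℝ) : ℝ := (Psi (-u) + Psi u) * dPhi v

lemma Psi_eq (u : ℝ) : Psi u = 1 - Real.exp (-(max u 0) ^ 2) := by
  unfold Psi
  split_ifs with h
  · simp [max_eq_right h]
  · rw [max_eq_left (le_of_not_ge h)]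

lemma Psi_neg_add_Psi (u : ℝ) : Psi (-u) + Psi u = 1 - Real.exp (-u ^ 2) := by
  rcases le_total u 0 with h | h
  · rw [Psi_eq, Psi_eq, max_eq_left (by linarith), max_eq_right h]; simp
  · rw [Psi_eq, Psi_eq, max_eq_right (by linarith), max_eq_left h]; simp

lemma Psi_nonneg (u : ℝ) : 0 ≤ Psi u := by
  rw [Psi_eq, sub_nonneg, Real.exp_le_one_iff]
  nlinarith [sq_nonneg (max u 0)]

lemma Psi_le_one (u : ℝ) : Psi u ≤ 1 := by
  rw [Psi_eq]; linarith [Real.exp_pos (-(max u 0) ^ 2)]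

lemma Psi_zero : Psi 0 = 0 := by simp [Psi]

lemma Psi_of_nonpos {u : ℝ} (hu : u ≤ 0) : Psi u = 0 := by simp [Psi, hu]

/-- Squaring removes the kink of the positive part: near `0` the function is at most `u ^ 2`, hence
`o(u)`. This is what makes `Psi` differentiable at `0`. -/
lemma hasDerivAt_max_sq (u : ℝ) : HasDerivAt (fun u : ℝ => (max u 0) ^ 2) (2 * max u 0) u := by
  rcases lt_trichotomy u 0 with h | h | h
  · rw [max_eq_right h.le, mul_zero]
    refine (hasDerivAt_const u (0 : ℝ)).congr_of_eventuallyEq ?_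
    filter_upwards [eventually_lt_nhds h] with v hv
    simp [max_eq_right hv.le]
  · subst h
    rw [max_self, mul_zero, hasDerivAt_iff_isLittleO]
    simp only [max_self, smul_zero, sub_zero, ne_eq, OfNat.ofNat_ne_zero, not_false_eq_true,
      zero_pow]
    have h1 : (fun x : ℝ => (max x 0) ^ 2) =O[nhds 0] fun x : ℝ => x ^ 2 := by
      refine Asymptotics.IsBigO.of_bound 1 (Filter.Eventually.of_forall fun x => ?_)
      rw [one_mul, Real.norm_of_nonneg (sq_nonneg _), Real.norm_of_nonneg (sq_nonneg _)]
      rcases le_total x 0 with hx | hx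
      · rw [max_eq_right hx]; nlinarith [sq_nonneg x]
      · rw [max_eq_left hx]
    exact h1.trans_isLittleO (Asymptotics.isLittleO_pow_id (by norm_num))
  · rw [max_eq_left h.le]
    have h2 := hasDerivAt_pow 2 u
    simp only [Nat.cast_ofNat, Nat.add_one_sub_one, pow_one] at h2
    refine h2.congr_of_eventuallyEq ?_
    filter_upwards [eventually_gt_nhds h] with v hv
    simp [max_eq_left hv.le]

lemma hasDerivAt_Psi (u : ℝ) : HasDerivAt Psi (dPsi u) u := by
  have h := ((hasDerivAt_max_sq u).neg.exp).const_sub 1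
  have he : Psi = fun u => 1 - Real.exp (-(max u 0) ^ 2) := funext Psi_eq
  rw [he]
  refine h.congr_deriv ?_
  simp only [dPsi, Pi.neg_apply]; ring

lemma hasDerivAt_Phi (v : ℝ) : HasDerivAt Phi (dPhi v) v := by
  have h := ((Real.hasDerivAt_arctan v).const_mul 4).add_const (2 * Real.pi)
  refine h.congr_deriv ?_
  simp only [dPhi]; ring

lemma Phi_pos (v : ℝ) : 0 < Phi v := by
  unfold Phi; linarith [Real.neg_pi_div_two_lt_arctan v]

lemma Phi_lt (v : ℝ) : Phi v < 4 * Real.pi := by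
  unfold Phi; linarith [Real.arctan_lt_pi_div_two v]

lemma dPhi_pos (v : ℝ) : 0 < dPhi v := by unfold dPhi; positivity

lemma dPhi_neg (v : ℝ) : dPhi (-v) = dPhi v := by simp [dPhi]

lemma dPhi_le (v : ℝ) : dPhi v ≤ 4 := by
  unfold dPhi
  rw [div_le_iff₀ (by positivity)]; nlinarith [sq_nonneg v]

lemma dPsi_nonneg (u : ℝ) : 0 ≤ dPsi u := by
  unfold dPsi
  have := le_max_right u 0
  positivity

lemma dPsi_of_nonpos {u : ℝ} (hu : u ≤ 0) : dPsi u = 0 := by simp [dPsi, hu]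

lemma dPsi_le_one (u : ℝ) : dPsi u ≤ 1 := by
  unfold dPsi
  set w := max u 0
  have h := Real.add_one_le_exp (w ^ 2)
  rw [Real.exp_neg, ← div_eq_mul_inv, div_le_one (Real.exp_pos _)]
  nlinarith [sq_nonneg (w - 1)]

lemma abs_sub_le_of_hasDerivAt {f f' : ℝ → ℝ} {C : ℝ} (hf : ∀ u, HasDerivAt f (f' u) u)
    (hC : ∀ u, |f' u| ≤ C) (u v : ℝ) : |f u - f v| ≤ C * |u - v| :=
  Convex.norm_image_sub_le_of_norm_hasDerivWithin_le (s := Set.univ)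
    (fun x _ => (hf x).hasDerivWithinAt) (fun x _ => hC x) convex_univ
    (Set.mem_univ v) (Set.mem_univ u)

lemma abs_Psi_sub_le (u v : ℝ) : |Psi u - Psi v| ≤ |u - v| := by
  simpa using abs_sub_le_of_hasDerivAt (C := 1) hasDerivAt_Psi
    (fun u => by rw [abs_of_nonneg (dPsi_nonneg u)]; exact dPsi_le_one u) u v

lemma abs_Phi_sub_le (u v : ℝ) : |Phi u - Phi v| ≤ 4 * |u - v| :=
  abs_sub_le_of_hasDerivAt hasDerivAt_Phi
    (fun u => by rw [abs_of_nonneg (dPhi_pos u).le]; exact dPhi_le u) u v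

lemma abs_dPhi_sub_le (u v : ℝ) : |dPhi u - dPhi v| ≤ 4 * |u - v| := by
  have hu : (0 : ℝ) < 1 + u ^ 2 := by positivity
  have hv : (0 : ℝ) < 1 + v ^ 2 := by positivity
  have h : dPhi u - dPhi v = 4 * ((v - u) * ((u + v) / ((1 + u ^ 2) * (1 + v ^ 2)))) := by
    unfold dPhi; field_simp; ring
  have h1 : |(u + v) / ((1 + u ^ 2) * (1 + v ^ 2))| ≤ 1 := by
    rw [abs_div, abs_of_pos (mul_pos hu hv), div_le_one (mul_pos hu hv), abs_le]
    constructor <;>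
      nlinarith [sq_nonneg (u - 1), sq_nonneg (v - 1), sq_nonneg (u + 1), sq_nonneg (v + 1),
        sq_nonneg (u * v)]
  rw [h, abs_mul, abs_mul, abs_sub_comm v u, abs_of_pos (four_pos : (0:ℝ) < 4)]
  nlinarith [abs_nonneg (u - v)]

/-- `dPsi` is `w ↦ 2 w exp (-w²)`, whose derivative is at most `2` in absolute value, composed with
the 1-Lipschitz positive part; this avoids differentiating at the kink. -/
lemma abs_dPsi_sub_le (u v : ℝ) : |dPsi u - dPsi v| ≤ 2 * |u - v| := by
  have key := abs_sub_le_of_hasDerivAt (C := 2) (f := fun w : ℝ => 2 * w * Real.exp (-w ^ 2))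
    (f' := fun w => (2 - 4 * w ^ 2) * Real.exp (-w ^ 2)) (fun w => by
      have h := ((hasDerivAt_id w).const_mul 2).mul ((hasDerivAt_pow 2 w).neg.exp)
      refine h.congr_deriv ?_
      simp; ring) (fun w => by
      have h0 := Real.quadratic_le_exp_of_nonneg (sq_nonneg w)
      have hp := Real.exp_pos (w ^ 2)
      rw [Real.exp_neg, ← div_eq_mul_inv, abs_div, abs_of_pos hp, div_le_iff₀ hp, abs_le]
      constructor <;> nlinarith [sq_nonneg w, sq_nonneg (w ^ 2 - 1)]) (max u 0) (max v 0)
  refine key.trans ?_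
  have := abs_max_sub_max_le_abs u v 0
  linarith

lemma linkFst_nonneg (u v : ℝ) : 0 ≤ linkFst u v :=
  add_nonneg (mul_nonneg (dPsi_nonneg _) (Phi_pos _).le)
    (mul_nonneg (dPsi_nonneg _) (Phi_pos _).le)

/-- Whatever the sign of `u`, one of the two summands vanishes, so the bound of a single summand
suffices. -/
lemma linkFst_le (u v : ℝ) : linkFst u v ≤ 4 * Real.pi := by
  have aux : ∀ a b : ℝ, dPsi a * Phi b ≤ 4 * Real.pi := fun a b => by
    have h1 := mul_le_mul (dPsi_le_one a) (Phi_lt b).le (Phi_pos b).le zero_le_one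
    linarith
  unfold linkFst
  rcases le_total u 0 with h | h
  · rw [dPsi_of_nonpos h]; linarith [aux (-u) (-v)]
  · rw [dPsi_of_nonpos (neg_nonpos.2 h)]; linarith [aux u v]

/-- With `linkSnd_zero` this is the zero-chain property: a link whose first argument is zero
contributes nothing to the gradient. -/
lemma linkFst_zero (v : ℝ) : linkFst 0 v = 0 := by
  simp [linkFst, dPsi_of_nonpos]

lemma linkSnd_zero (v : ℝ) : linkSnd 0 v = 0 := by
  simp [linkSnd, Psi_zero]

lemma Psi_sum_nonneg (u : ℝ) : 0 ≤ Psi (-u) + Psi u := add_nonneg (Psi_nonneg _) (Psi_nonneg _)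

lemma Psi_sum_le_one (u : ℝ) : Psi (-u) + Psi u ≤ 1 := by
  rw [Psi_neg_add_Psi]; linarith [Real.exp_pos (-u ^ 2)]

lemma linkSnd_nonneg (u v : ℝ) : 0 ≤ linkSnd u v := mul_nonneg (Psi_sum_nonneg u) (dPhi_pos v).le

lemma linkSnd_le (u v : ℝ) : linkSnd u v ≤ 4 := by
  have h1 := mul_le_mul (Psi_sum_le_one u) (dPhi_le v) (dPhi_pos v).le zero_le_one
  unfold linkSnd; linarith

/-- The margins `9/10` and `11/10` are the threshold `1` loosened by the deviation `1/10` between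
blocks. The two factors are at least `1 - 1/1.81 > 0.44` and `4/2.21 > 1.8`. -/
lemma linkSnd_ge {u v : ℝ} (hu : 9 / 10 ≤ |u|) (hv : |v| ≤ 11 / 10) : 3 / 4 ≤ linkSnd u v := by
  have hu2 : 81 / 100 ≤ u ^ 2 := by rw [← sq_abs]; nlinarith
  have hv2 : v ^ 2 ≤ 121 / 100 := by rw [← sq_abs]; nlinarith [abs_nonneg v]
  have h1 : 44 / 100 ≤ Psi (-u) + Psi u := by
    rw [Psi_neg_add_Psi, Real.exp_neg]
    have h2 := Real.add_one_le_exp (u ^ 2)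
    have h3 : (Real.exp (u ^ 2))⁻¹ ≤ 56 / 100 := by
      rw [inv_le_comm₀ (Real.exp_pos _) (by norm_num)]; norm_num; linarith
    linarith
  have h4 : 18 / 10 ≤ dPhi v := by
    unfold dPhi; rw [le_div_iff₀ (by positivity)]; linarith
  unfold linkSnd
  nlinarith

/-- The identity `Phi (-v) + Phi v = 4π` lets the two variations of `dPsi` share one factor `4π`,
giving `8π` rather than `16π`. -/
lemma abs_linkFst_sub_le (u v u' v' : ℝ) :
    |linkFst u v - linkFst u' v'| ≤ 8 * Real.pi * |u - u'| + 8 * |v - v'| := by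
  have e : linkFst u v - linkFst u' v' =
      ((dPsi (-u) - dPsi (-u')) * Phi (-v) + (dPsi u - dPsi u') * Phi v) +
      (dPsi (-u') * (Phi (-v) - Phi (-v')) + dPsi u' * (Phi v - Phi v')) := by
    unfold linkFst; ring
  have hΦ : Phi (-v) + Phi v = 4 * Real.pi := by unfold Phi; rw [Real.arctan_neg]; ring
  have hneg : ∀ a b : ℝ, |-a - -b| = |a - b| := fun a b => by
    rw [← abs_neg]; congr 1; ring
  have b1 : |(dPsi (-u) - dPsi (-u')) * Phi (-v)| ≤ 2 * |u - u'| * Phi (-v) := by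
    rw [abs_mul, abs_of_pos (Phi_pos _)]
    have := abs_dPsi_sub_le (-u) (-u'); rw [hneg] at this
    exact mul_le_mul_of_nonneg_right this (Phi_pos _).le
  have b2 : |(dPsi u - dPsi u') * Phi v| ≤ 2 * |u - u'| * Phi v := by
    rw [abs_mul, abs_of_pos (Phi_pos _)]
    exact mul_le_mul_of_nonneg_right (abs_dPsi_sub_le u u') (Phi_pos _).le
  have aux : ∀ a b b' : ℝ, |dPsi a * (Phi b - Phi b')| ≤ 4 * |b - b'| := fun a b b' => by
    rw [abs_mul, abs_of_nonneg (dPsi_nonneg a)]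
    have := mul_le_mul (dPsi_le_one a) (abs_Phi_sub_le b b') (abs_nonneg _) zero_le_one
    linarith
  have b3 := aux (-u') (-v) (-v'); rw [hneg] at b3
  have b4 := aux u' v v'
  rw [e]
  refine (abs_add_le _ _).trans ?_
  have c1 := (abs_add_le _ _).trans (add_le_add b1 b2)
  have c2 := (abs_add_le _ _).trans (add_le_add b3 b4)
  have : 2 * |u - u'| * Phi (-v) + 2 * |u - u'| * Phi v = 8 * Real.pi * |u - u'| := by
    rw [← mul_add, hΦ]; ring
  linarith

lemma abs_linkSnd_sub_le (u v u' v' : ℝ) :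
    |linkSnd u v - linkSnd u' v'| ≤ 8 * |u - u'| + 4 * |v - v'| := by
  have e : linkSnd u v - linkSnd u' v' =
      ((Psi (-u) - Psi (-u')) + (Psi u - Psi u')) * dPhi v +
      (Psi (-u') + Psi u') * (dPhi v - dPhi v') := by
    unfold linkSnd; ring
  have hneg : |-u - -u'| = |u - u'| := by rw [← abs_neg]; congr 1; ring
  have b0 : |(Psi (-u) - Psi (-u')) + (Psi u - Psi u')| ≤ 2 * |u - u'| := by
    refine (abs_add_le _ _).trans ?_
    have := abs_Psi_sub_le (-u) (-u'); rw [hneg] at this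
    linarith [abs_Psi_sub_le u u']
  rw [e]
  refine (abs_add_le _ _).trans (add_le_add ?_ ?_)
  · rw [abs_mul, abs_of_pos (dPhi_pos v)]
    have := mul_le_mul b0 (dPhi_le v) (dPhi_pos v).le (by positivity)
    linarith
  · rw [abs_mul, abs_of_nonneg (Psi_sum_nonneg u')]
    have := mul_le_mul (Psi_sum_le_one u') (abs_dPhi_sub_le v v') (abs_nonneg _) zero_le_one
    linarith

lemma link_ge (u v : ℝ) : -(4 * Real.pi) ≤ link u v := by
  unfold link
  have h1 := mul_le_mul (Psi_le_one u) (Phi_lt v).le (Phi_pos v).le zero_le_one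
  have h2 := mul_nonneg (Psi_nonneg (-u)) (Phi_pos (-v)).le
  linarith

lemma link_zero (v : ℝ) : link 0 v = 0 := by simp [link, Psi_zero]

end HardInstance

/-! ### The chain form of `h` and the gradient of `f₀` -/

namespace HardInstance

variable {dbar : ℕ}

/-- The coordinates of `z` counted from `1`, with the value `1` put in front at the index `0`. -/
noncomputable def chain (z : Fin dbar → ℝ) (k : ℕ) : ℝ := if k = 0 then 1 else coord z k

/-- The coefficient of `phi z (j + 1)` in `h m₁ m₂ i z`. -/
noncomputable def weight (m₁ m₂ dbar i j : ℕ) : ℝ :=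
  if dbar ≤ j then 0 else if j = 0 then 1
  else if (i ≤ m₁ * m₂ ∧ Odd j) ∨ (2 * (m₁ * m₂) < i ∧ Even j) then 3 else 0

lemma weight_nonneg (m₁ m₂ dbar i j : ℕ) : 0 ≤ weight m₁ m₂ dbar i j := by
  unfold weight; split_ifs <;> norm_num

lemma weight_le (m₁ m₂ dbar i j : ℕ) : weight m₁ m₂ dbar i j ≤ 3 := by
  unfold weight; split_ifs <;> norm_num

lemma coord_succ (z : Fin dbar → ℝ) (j : Fin dbar) : coord z ((j : ℕ) + 1) = z j := by
  have := j.2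
  unfold coord
  rw [dif_pos ⟨by omega, by omega⟩]
  congr

lemma chain_zero (z : Fin dbar → ℝ) : chain z 0 = 1 := by simp [chain]

lemma chain_succ (z : Fin dbar → ℝ) (j : Fin dbar) : chain z ((j : ℕ) + 1) = z j := by
  simp [chain, coord_succ]

/-- The artificial entry `1` at index `0` absorbs the special case of `phi z 1`, because `Psi (-1) =
0`. -/
lemma phi_succ (z : Fin dbar → ℝ) (j : ℕ) :
    phi z (j + 1) = link (chain z j) (chain z (j + 1)) := by
  rcases Nat.eq_zero_or_pos j with rfl | hj
  · simp [phi, link, chain, Psi_of_nonpos]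
  · have : j ≠ 0 := by omega
    simp [phi, link, chain, this]

lemma sum_range_odd_weight (g : ℕ → ℝ) (q : ℕ) :
    ∑ j ∈ Finset.range (2 * q + 1), (if j = 0 then 1 else if Odd j then (3 : ℝ) else 0) * g (j + 1) =
      g 1 + 3 * ∑ j ∈ Finset.Icc 1 q, g (2 * j) := by
  induction q with
  | zero => simp
  | succ q ih =>
    rw [show 2 * (q + 1) + 1 = 2 * q + 1 + 1 + 1 by ring, Finset.sum_range_succ,
      Finset.sum_range_succ, ih, Finset.sum_Icc_succ_top (by omega)]
    have h1 : Odd (2 * q + 1) := ⟨q, rfl⟩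
    have h2 : ¬ Odd (2 * q + 1 + 1) := by rw [Nat.not_odd_iff_even]; exact ⟨q + 1, by ring⟩
    rw [if_neg (by omega), if_pos h1, if_neg (by omega), if_neg h2]
    rw [show 2 * (q + 1) = 2 * q + 1 + 1 by ring]
    ring

lemma sum_range_even_weight (g : ℕ → ℝ) (q : ℕ) :
    ∑ j ∈ Finset.range (2 * q + 1), (if j = 0 then 1 else if Even j then (3 : ℝ) else 0) * g (j + 1) =
      g 1 + 3 * ∑ j ∈ Finset.Icc 1 q, g (2 * j + 1) := by
  induction q with
  | zero => simp
  | succ q ih =>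
    rw [show 2 * (q + 1) + 1 = 2 * q + 1 + 1 + 1 by ring, Finset.sum_range_succ,
      Finset.sum_range_succ, ih, Finset.sum_Icc_succ_top (by omega)]
    have h1 : ¬ Even (2 * q + 1) := by rw [Nat.not_even_iff_odd]; exact ⟨q, rfl⟩
    have h2 : Even (2 * q + 1 + 1) := ⟨q + 1, by ring⟩
    rw [if_neg (by omega), if_neg h1, if_neg (by omega), if_pos h2]
    rw [show 2 * (q + 1) = 2 * q + 1 + 1 by ring]
    ring

lemma h_eq_sum (m₁ m₂ : ℕ) (hd : Odd dbar) (i : ℕ) (z : Fin dbar → ℝ) :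
    h m₁ m₂ i z = ∑ j ∈ Finset.range dbar,
      weight m₁ m₂ dbar i j * link (chain z j) (chain z (j + 1)) := by
  simp_rw [← phi_succ]
  obtain ⟨q, hq⟩ := hd
  have hq2 : dbar / 2 = q := by omega
  unfold h
  rw [hq2]
  split_ifs with h1 h2
  · rw [← sum_range_odd_weight, ← hq]
    refine Finset.sum_congr rfl fun j hj => ?_
    have hj' := Finset.mem_range.1 hj
    have h3 : ¬ 2 * (m₁ * m₂) < i := by omega
    simp [weight, h1, h3, Nat.not_le.2 hj']
  · rw [Finset.sum_eq_single 0]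
    · simp [weight]; omega
    · intro j hj hj0
      have h3 : ¬ 2 * (m₁ * m₂) < i := by omega
      simp [weight, h1, h3, hj0]
    · simp [hq]
  · rw [← sum_range_even_weight, ← hq]
    refine Finset.sum_congr rfl fun j hj => ?_
    have hj' := Finset.mem_range.1 hj
    have h3 : 2 * (m₁ * m₂) < i := by omega
    simp [weight, h1, h3, Nat.not_le.2 hj']

/-- Every link is at least `-4π`, and with `dbar = 2q + 1` the total weight is at most `1 + 3q`,
where `4π (1 + 3q) ≤ 6π (2q + 1)`. -/
lemma h_ge (m₁ m₂ : ℕ) (hd : Odd dbar) (i : ℕ) (z : Fin dbar → ℝ) :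
    -(6 * Real.pi * dbar) ≤ h m₁ m₂ i z := by
  have hphi : ∀ j, -(4 * Real.pi) ≤ phi z (j + 1) := fun j => by
    rw [phi_succ]; exact link_ge _ _
  obtain ⟨q, hq⟩ := hd
  have hq2 : dbar / 2 = q := by omega
  have hcast : (dbar : ℝ) = 2 * q + 1 := by rw [hq]; push_cast; ring
  have hπ := Real.pi_pos
  have hsum : ∀ k : ℕ → ℕ, (∀ j ∈ Finset.Icc 1 q, 1 ≤ k j) →
      -(4 * Real.pi) * q ≤ ∑ j ∈ Finset.Icc 1 q, phi z (k j) := fun k hk => by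
    have := Finset.card_nsmul_le_sum (Finset.Icc 1 q) (fun j => phi z (k j)) (-(4 * Real.pi))
      (fun j hj => by
        have h1 := hk j hj
        have h2 := hphi (k j - 1)
        rwa [Nat.sub_add_cancel h1] at h2)
    simp only [Nat.card_Icc, Nat.add_sub_cancel, nsmul_eq_mul] at this
    linarith
  have hq0 : (0 : ℝ) ≤ q := q.cast_nonneg
  have hπq := mul_nonneg hπ.le hq0
  have h0 := hphi 0
  unfold h
  rw [hq2, hcast]
  split_ifs with h1 h2
  · have := hsum (fun j => 2 * j) (fun j hj => by have := Finset.mem_Icc.1 hj; omega)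
    simp only [zero_add] at h0
    linarith
  · simp only [zero_add] at h0
    linarith
  · have := hsum (fun j => 2 * j + 1) (fun j hj => by omega)
    simp only [zero_add] at h0
    linarith

lemma h_zero_nonpos (m₁ m₂ : ℕ) (hd : Odd dbar) (i : ℕ) :
    h m₁ m₂ i (0 : Fin dbar → ℝ) ≤ 0 := by
  rw [h_eq_sum m₁ m₂ hd]
  refine Finset.sum_nonpos fun j _ => ?_
  refine mul_nonpos_of_nonneg_of_nonpos (weight_nonneg _ _ _ _ _) ?_
  rcases Nat.eq_zero_or_pos j with rfl | hj
  · rw [chain_zero]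
    have h1 := mul_nonneg (Psi_nonneg 1) (Phi_pos (chain (0 : Fin dbar → ℝ) (0 + 1))).le
    have h2 : Psi (-1) = 0 := Psi_of_nonpos (by norm_num)
    simp only [link, h2]
    linarith
  · have : chain (0 : Fin dbar → ℝ) j = 0 := by simp [chain, coord, hj.ne']
    rw [this, link_zero]

variable (δ Lf : ℝ) (m₁ m₂ : ℕ)

/-- The factor in front of `h` in the definition of `f`. -/
noncomputable def outerScale : ℝ := 300 * Real.pi * δ ^ 2 / ((m m₁ m₂ : ℝ) * Lf)

/-- The scaling of the argument of `h` in the definition of `f`. -/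
noncomputable def innerScale : ℝ := √(m m₁ m₂ : ℝ) * Lf / (150 * Real.pi * δ)

/-- The scaled block `i` of `x`, as a sequence. -/
noncomputable def scaled (x : EuclideanSpace ℝ (Fin (m m₁ m₂) × Fin dbar)) (i : Fin (m m₁ m₂))
    (k : ℕ) : ℝ :=
  chain (innerScale δ Lf m₁ m₂ • fun j => x (i, j)) k

/-- The linear form `x ↦ [x_i]_k`. -/
noncomputable def coordForm (i : Fin (m m₁ m₂)) (k : ℕ) :
    EuclideanSpace ℝ (Fin (m m₁ m₂) × Fin dbar) →L[ℝ] ℝ :=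
  if hk : 1 ≤ k ∧ k ≤ dbar then EuclideanSpace.proj (i, ⟨k - 1, by omega⟩) else 0

/-- The negative of a partial derivative of `h` at the scaled block `i` of `x`. -/
noncomputable def slope (x : EuclideanSpace ℝ (Fin (m m₁ m₂) × Fin dbar)) (i : Fin (m m₁ m₂))
    (j : ℕ) : ℝ :=
  weight m₁ m₂ dbar (i + 1) j *
      linkSnd (scaled δ Lf m₁ m₂ x i j) (scaled δ Lf m₁ m₂ x i (j + 1)) +
    weight m₁ m₂ dbar (i + 1) (j + 1) *
      linkFst (scaled δ Lf m₁ m₂ x i (j + 1)) (scaled δ Lf m₁ m₂ x i (j + 2))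

/-- The gradient of `f₀`. -/
noncomputable def grad (x : EuclideanSpace ℝ (Fin (m m₁ m₂) × Fin dbar)) :
    EuclideanSpace ℝ (Fin (m m₁ m₂) × Fin dbar) :=
  WithLp.toLp 2 fun p => -(outerScale δ Lf m₁ m₂ * innerScale δ Lf m₁ m₂ * slope δ Lf m₁ m₂ x p.1 p.2)

lemma scaled_zero (x : EuclideanSpace ℝ (Fin (m m₁ m₂) × Fin dbar)) (i : Fin (m m₁ m₂)) :
    scaled δ Lf m₁ m₂ x i 0 = 1 := chain_zero _

lemma scaled_succ (x : EuclideanSpace ℝ (Fin (m m₁ m₂) × Fin dbar)) (i : Fin (m m₁ m₂))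
    (j : Fin dbar) : scaled δ Lf m₁ m₂ x i ((j : ℕ) + 1) = innerScale δ Lf m₁ m₂ * x (i, j) := by
  unfold scaled; rw [chain_succ]; rfl

lemma scaled_of_lt (x : EuclideanSpace ℝ (Fin (m m₁ m₂) × Fin dbar)) (i : Fin (m m₁ m₂))
    {k : ℕ} (hk : dbar < k) : scaled δ Lf m₁ m₂ x i k = 0 := by
  have h1 : ¬ (1 ≤ k ∧ k ≤ dbar) := by omega
  have h2 : k ≠ 0 := by omega
  simp [scaled, chain, coord, h1, h2]

lemma coordForm_succ (i : Fin (m m₁ m₂)) (j : Fin dbar)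
    (v : EuclideanSpace ℝ (Fin (m m₁ m₂) × Fin dbar)) :
    coordForm m₁ m₂ i ((j : ℕ) + 1) v = v (i, j) := by
  have := j.2
  unfold coordForm
  rw [dif_pos ⟨by omega, by omega⟩]
  simp

lemma coordForm_zero (i : Fin (m m₁ m₂)) : coordForm (dbar := dbar) m₁ m₂ i 0 = 0 := by
  simp [coordForm]

lemma hasFDerivAt_scaled (x : EuclideanSpace ℝ (Fin (m m₁ m₂) × Fin dbar)) (i : Fin (m m₁ m₂))
    (k : ℕ) : HasFDerivAt (fun x => scaled δ Lf m₁ m₂ x i k)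
      (innerScale δ Lf m₁ m₂ • coordForm m₁ m₂ i k) x := by
  rcases Nat.eq_zero_or_pos k with rfl | hk
  · simp only [scaled_zero, coordForm_zero, smul_zero]
    exact hasFDerivAt_const _ _
  · by_cases hkd : k ≤ dbar
    · obtain ⟨j, rfl⟩ : ∃ j : Fin dbar, k = (j : ℕ) + 1 := ⟨⟨k - 1, by omega⟩, by simp; omega⟩
      have : (fun x : EuclideanSpace ℝ (Fin (m m₁ m₂) × Fin dbar) =>
            scaled δ Lf m₁ m₂ x i ((j : ℕ) + 1)) =
          fun x => (innerScale δ Lf m₁ m₂ • coordForm m₁ m₂ i ((j : ℕ) + 1)) x := by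
        funext x
        rw [scaled_succ, smul_apply, coordForm_succ, smul_eq_mul]
      rw [this]
      exact ContinuousLinearMap.hasFDerivAt _
    · simp only [scaled_of_lt δ Lf m₁ m₂ _ i (Nat.lt_of_not_le hkd)]
      have : coordForm (dbar := dbar) m₁ m₂ i k = 0 := by simp [coordForm, hkd]
      rw [this, smul_zero]
      exact hasFDerivAt_const _ _

lemma hasFDerivAt_link {E : Type*} [NormedAddCommGroup E] [NormedSpace ℝ E] {a b : E → ℝ}
    {a' b' : E →L[ℝ] ℝ} {x : E} (ha : HasFDerivAt a a' x) (hb : HasFDerivAt b b' x) :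
    HasFDerivAt (fun x => link (a x) (b x))
      (-(linkFst (a x) (b x) • a' + linkSnd (a x) (b x) • b')) x := by
  have h1 := (hasDerivAt_Psi (-a x)).comp_hasFDerivAt x ha.neg
  have h2 := (hasDerivAt_Psi (a x)).comp_hasFDerivAt x ha
  have h3 := (hasDerivAt_Phi (-b x)).comp_hasFDerivAt x hb.neg
  have h4 := (hasDerivAt_Phi (b x)).comp_hasFDerivAt x hb
  have h5 := (h1.mul h3).sub (h2.mul h4)
  refine HasFDerivAt.congr_fderiv (f := fun x => link (a x) (b x)) h5 ?_
  ext v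
  simp [linkFst, linkSnd, dPhi_neg]
  ring

lemma f₀_eq (hd : Odd dbar) (x : EuclideanSpace ℝ (Fin (m m₁ m₂) × Fin dbar)) :
    f₀ δ Lf m₁ m₂ dbar x = ∑ i : Fin (m m₁ m₂), outerScale δ Lf m₁ m₂ * ∑ j ∈ Finset.range dbar,
      weight m₁ m₂ dbar (i + 1) j *
        link (scaled δ Lf m₁ m₂ x i j) (scaled δ Lf m₁ m₂ x i (j + 1)) := by
  unfold f₀ f
  refine Finset.sum_congr rfl fun i _ => ?_
  rw [h_eq_sum m₁ m₂ hd]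
  rfl

/-- Used to regroup the derivative of `f₀` by coordinate instead of by link; the boundary terms
vanish because the weight is `0` from index `dbar` on and the chain entry `0` is constant. -/
lemma sum_shift (α v : ℕ → ℝ) (d : ℕ) (hα : α d = 0) (hv : v 0 = 0) :
    ∑ j ∈ Finset.range d, α j * v j = ∑ j ∈ Finset.range d, α (j + 1) * v (j + 1) := by
  have h1 := Finset.sum_range_succ (fun j => α j * v j) d
  have h2 := Finset.sum_range_succ' (fun j => α j * v j) d
  simp only [hα, hv] at h1 h2
  linarith

lemma hasGradientAt_f₀ (hd : Odd dbar) (x : EuclideanSpace ℝ (Fin (m m₁ m₂) × Fin dbar)) :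
    HasGradientAt (f₀ δ Lf m₁ m₂ dbar) (grad δ Lf m₁ m₂ x) x := by
  rw [hasGradientAt_iff_hasFDerivAt]
  have he : f₀ δ Lf m₁ m₂ dbar = _ := funext (f₀_eq δ Lf m₁ m₂ hd)
  rw [he]
  have key : HasFDerivAt _ _ x := HasFDerivAt.fun_sum (u := Finset.univ)
    fun (i : Fin (m m₁ m₂)) _ => (HasFDerivAt.fun_sum (u := Finset.range dbar) fun j _ =>
      (hasFDerivAt_link (hasFDerivAt_scaled δ Lf m₁ m₂ x i j)
        (hasFDerivAt_scaled δ Lf m₁ m₂ x i (j + 1))).const_mul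
          (weight m₁ m₂ dbar (i + 1) j)).const_mul (outerScale δ Lf m₁ m₂)
  refine key.congr_fderiv ?_
  ext v
  rw [InnerProductSpace.toDual_apply_apply, PiLp.inner_apply, Fintype.sum_prod_type]
  simp only [sum_apply, smul_apply,
    neg_apply, add_apply, smul_eq_mul]
  refine Finset.sum_congr rfl fun i _ => ?_
  have e1 : ∀ j : Fin dbar, Inner.inner ℝ (grad δ Lf m₁ m₂ x (i, j)) (v (i, j)) =
      -(outerScale δ Lf m₁ m₂ * innerScale δ Lf m₁ m₂ * slope δ Lf m₁ m₂ x i j) *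
        coordForm m₁ m₂ i ((j : ℕ) + 1) v := fun j => by
    rw [coordForm_succ]; simp [grad, mul_comm]
  simp_rw [e1]
  rw [Fin.sum_univ_eq_sum_range (fun j => -(outerScale δ Lf m₁ m₂ * innerScale δ Lf m₁ m₂ *
    slope δ Lf m₁ m₂ x i j) * coordForm m₁ m₂ i (j + 1) v) dbar]
  have hs := sum_shift (fun j => weight m₁ m₂ dbar (i + 1) j *
      linkFst (scaled δ Lf m₁ m₂ x i j) (scaled δ Lf m₁ m₂ x i (j + 1)))
    (fun j => coordForm m₁ m₂ i j v) dbar (by simp [weight]) (by simp [coordForm_zero])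
  rw [Finset.mul_sum]
  have e2 : ∀ j, outerScale δ Lf m₁ m₂ * (weight m₁ m₂ dbar (i + 1) j *
      -(linkFst (scaled δ Lf m₁ m₂ x i j) (scaled δ Lf m₁ m₂ x i (j + 1)) *
          (innerScale δ Lf m₁ m₂ * coordForm m₁ m₂ i j v) +
        linkSnd (scaled δ Lf m₁ m₂ x i j) (scaled δ Lf m₁ m₂ x i (j + 1)) *
          (innerScale δ Lf m₁ m₂ * coordForm m₁ m₂ i (j + 1) v))) =
      -(outerScale δ Lf m₁ m₂ * innerScale δ Lf m₁ m₂) * (weight m₁ m₂ dbar (i + 1) j *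
        linkFst (scaled δ Lf m₁ m₂ x i j) (scaled δ Lf m₁ m₂ x i (j + 1)) *
          coordForm m₁ m₂ i j v) +
      -(outerScale δ Lf m₁ m₂ * innerScale δ Lf m₁ m₂) * (weight m₁ m₂ dbar (i + 1) j *
        linkSnd (scaled δ Lf m₁ m₂ x i j) (scaled δ Lf m₁ m₂ x i (j + 1)) *
          coordForm m₁ m₂ i (j + 1) v) := fun j => by ring
  simp_rw [e2]
  rw [Finset.sum_add_distrib, ← Finset.mul_sum, hs, Finset.mul_sum, ← Finset.sum_add_distrib]
  refine Finset.sum_congr rfl fun j _ => ?_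
  unfold slope
  ring

end HardInstance

/-! ### Smoothness of `f₀`, lower bound of `F`, and the gap -/

namespace HardInstance

variable {dbar : ℕ} {δ Lf : ℝ} {m₁ m₂ : ℕ}

lemma outerScale_pos (hδ : 0 < δ) (hLf : 0 < Lf) (hm : 0 < m m₁ m₂) :
    0 < outerScale δ Lf m₁ m₂ := by
  have : (0 : ℝ) < (m m₁ m₂ : ℕ) := Nat.cast_pos.2 hm
  unfold outerScale; positivity

lemma innerScale_pos (hδ : 0 < δ) (hLf : 0 < Lf) (hm : 0 < m m₁ m₂) :
    0 < innerScale δ Lf m₁ m₂ := by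
  have : (0 : ℝ) < (m m₁ m₂ : ℕ) := Nat.cast_pos.2 hm
  unfold innerScale; positivity

/-- Every entry of the gradient is thus `-2δ / √m` times a slope; this fixes the scale for all
stationarity estimates. -/
lemma outerScale_mul_innerScale (hδ : 0 < δ) (hLf : 0 < Lf) (hm : 0 < m m₁ m₂) :
    outerScale δ Lf m₁ m₂ * innerScale δ Lf m₁ m₂ * √(m m₁ m₂ : ℝ) = 2 * δ := by
  have h0 : (0 : ℝ) < (m m₁ m₂ : ℕ) := Nat.cast_pos.2 hm
  have hs := Real.mul_self_sqrt h0.le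
  unfold outerScale innerScale
  generalize √((m m₁ m₂ : ℕ) : ℝ) = s at *
  rw [← hs]
  have : s ≠ 0 := by rintro rfl; rw [mul_zero] at hs; linarith
  field_simp
  norm_num

/-- `75π` is the Lipschitz constant used for the gradient of the unscaled `h`; the scaling turns it
into exactly `Lf`. -/
lemma outerScale_mul_innerScale_sq (hδ : 0 < δ) (hLf : 0 < Lf) (hm : 0 < m m₁ m₂) :
    outerScale δ Lf m₁ m₂ * innerScale δ Lf m₁ m₂ ^ 2 * (75 * Real.pi) = Lf := by
  have h0 : (0 : ℝ) < (m m₁ m₂ : ℕ) := Nat.cast_pos.2 hm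
  have hs := Real.sq_sqrt h0.le
  unfold outerScale innerScale
  rw [div_pow, mul_pow, hs]
  field_simp
  norm_num

lemma slope_nonneg (x : EuclideanSpace ℝ (Fin (m m₁ m₂) × Fin dbar)) (i : Fin (m m₁ m₂)) (j : ℕ) :
    0 ≤ slope δ Lf m₁ m₂ x i j :=
  add_nonneg (mul_nonneg (weight_nonneg _ _ _ _ _) (linkSnd_nonneg _ _))
    (mul_nonneg (weight_nonneg _ _ _ _ _) (linkFst_nonneg _ _))

lemma slope_le (x : EuclideanSpace ℝ (Fin (m m₁ m₂) × Fin dbar)) (i : Fin (m m₁ m₂)) (j : ℕ) :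
    slope δ Lf m₁ m₂ x i j ≤ 25 * Real.pi := by
  have h1 := mul_le_mul (weight_le m₁ m₂ dbar (i + 1) j)
    (linkSnd_le (scaled δ Lf m₁ m₂ x i j) (scaled δ Lf m₁ m₂ x i (j + 1))) (linkSnd_nonneg _ _)
    (by norm_num)
  have h2 := mul_le_mul (weight_le m₁ m₂ dbar (i + 1) (j + 1))
    (linkFst_le (scaled δ Lf m₁ m₂ x i (j + 1)) (scaled δ Lf m₁ m₂ x i (j + 2)))
    (linkFst_nonneg _ _) (by norm_num)
  unfold slope
  linarith [Real.pi_gt_three]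

lemma abs_slope_sub_le (x x' : EuclideanSpace ℝ (Fin (m m₁ m₂) × Fin dbar)) (i : Fin (m m₁ m₂))
    (j : ℕ) :
    |slope δ Lf m₁ m₂ x i j - slope δ Lf m₁ m₂ x' i j| ≤
      24 * |scaled δ Lf m₁ m₂ x i j - scaled δ Lf m₁ m₂ x' i j| +
      (12 + 24 * Real.pi) * |scaled δ Lf m₁ m₂ x i (j + 1) - scaled δ Lf m₁ m₂ x' i (j + 1)| +
      24 * |scaled δ Lf m₁ m₂ x i (j + 2) - scaled δ Lf m₁ m₂ x' i (j + 2)| := by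
  have aux : ∀ w a b c : ℝ, 0 ≤ w → w ≤ 3 → |a - b| ≤ c → |w * a - w * b| ≤ 3 * c := by
    intro w a b c h0 h3 hab
    rw [← mul_sub, abs_mul, abs_of_nonneg h0]
    exact mul_le_mul h3 hab (abs_nonneg _) (by norm_num)
  have h1 := aux _ _ _ _ (weight_nonneg m₁ m₂ dbar (i + 1) j) (weight_le m₁ m₂ dbar (i + 1) j)
    (abs_linkSnd_sub_le (scaled δ Lf m₁ m₂ x i j) (scaled δ Lf m₁ m₂ x i (j + 1))
      (scaled δ Lf m₁ m₂ x' i j) (scaled δ Lf m₁ m₂ x' i (j + 1)))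
  have h2 := aux _ _ _ _ (weight_nonneg m₁ m₂ dbar (i + 1) (j + 1))
    (weight_le m₁ m₂ dbar (i + 1) (j + 1))
    (abs_linkFst_sub_le (scaled δ Lf m₁ m₂ x i (j + 1)) (scaled δ Lf m₁ m₂ x i (j + 2))
      (scaled δ Lf m₁ m₂ x' i (j + 1)) (scaled δ Lf m₁ m₂ x' i (j + 2)))
  unfold slope
  rw [add_sub_add_comm]
  refine (abs_add_le _ _).trans ((add_le_add h1 h2).trans (le_of_eq ?_))
  ring

lemma sq_combination_le {α β γ a b c s : ℝ} (hα : 0 ≤ α) (hβ : 0 ≤ β) (hγ : 0 ≤ γ)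
    (hs : |s| ≤ α * a + β * b + γ * c) :
    s ^ 2 ≤ (α + β + γ) * (α * a ^ 2 + β * b ^ 2 + γ * c ^ 2) := by
  have h1 : s ^ 2 ≤ (α * a + β * b + γ * c) ^ 2 := by
    rw [← sq_abs]; exact pow_le_pow_left₀ (abs_nonneg _) hs 2
  have h2 := mul_nonneg (mul_nonneg hα hβ) (sq_nonneg (a - b))
  have h3 := mul_nonneg (mul_nonneg hα hγ) (sq_nonneg (a - c))
  have h4 := mul_nonneg (mul_nonneg hβ hγ) (sq_nonneg (b - c))
  nlinarith

/-- The Hessian of `h` is morally tridiagonal, so a Schur-type estimate applies: weighted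
Cauchy–Schwarz in each row, then a sum over rows. The constant is `24 + (12 + 24π) + 24 = 60 + 24π ≤
75π`. -/
lemma sum_slope_sub_sq_le (x x' : EuclideanSpace ℝ (Fin (m m₁ m₂) × Fin dbar))
    (i : Fin (m m₁ m₂)) :
    ∑ j ∈ Finset.range dbar, (slope δ Lf m₁ m₂ x i j - slope δ Lf m₁ m₂ x' i j) ^ 2 ≤
      (75 * Real.pi) ^ 2 * ∑ j ∈ Finset.range dbar,
        (scaled δ Lf m₁ m₂ x i (j + 1) - scaled δ Lf m₁ m₂ x' i (j + 1)) ^ 2 := by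
  have hπ := Real.pi_gt_three
  set e : ℕ → ℝ := fun k => (scaled δ Lf m₁ m₂ x i k - scaled δ Lf m₁ m₂ x' i k) ^ 2 with he
  have e0 : e 0 = 0 := by simp [he, scaled_zero]
  have ed : e (dbar + 1) = 0 := by simp [he, scaled_of_lt]
  have hpos : ∀ k, 0 ≤ e k := fun k => sq_nonneg _
  have hstep : ∀ j, (slope δ Lf m₁ m₂ x i j - slope δ Lf m₁ m₂ x' i j) ^ 2 ≤
      (24 + (12 + 24 * Real.pi) + 24) *
        (24 * e j + (12 + 24 * Real.pi) * e (j + 1) + 24 * e (j + 2)) := fun j => by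
    have := sq_combination_le (by norm_num) (by positivity) (by norm_num)
      (abs_slope_sub_le (δ := δ) (Lf := Lf) x x' i j)
    simpa only [sq_abs] using this
  -- Shifting the index loses nothing: the entry at `0` is the constant `1`, and the entry at `dbar
  -- + 1` is padding.
  have s1 : ∑ j ∈ Finset.range dbar, e j ≤ ∑ j ∈ Finset.range dbar, e (j + 1) := by
    have h1 := Finset.sum_range_succ e dbar
    have h2 := Finset.sum_range_succ' e dbar
    linarith [hpos dbar]
  have s2 : ∑ j ∈ Finset.range dbar, e (j + 2) ≤ ∑ j ∈ Finset.range dbar, e (j + 1) := by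
    have h1 := Finset.sum_range_succ (fun j => e (j + 1)) dbar
    have h2 := Finset.sum_range_succ' (fun j => e (j + 1)) dbar
    simp only [zero_add, add_assoc, Nat.reduceAdd] at h1 h2
    linarith [hpos 1]
  refine (Finset.sum_le_sum fun j _ => hstep j).trans ?_
  rw [← Finset.mul_sum, Finset.sum_add_distrib, Finset.sum_add_distrib, ← Finset.mul_sum,
    ← Finset.mul_sum, ← Finset.mul_sum]
  have hS : 0 ≤ ∑ j ∈ Finset.range dbar, e (j + 1) := Finset.sum_nonneg fun j _ => hpos _
  change _ ≤ (75 * Real.pi) ^ 2 * ∑ j ∈ Finset.range dbar, e (j + 1)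
  set S := ∑ j ∈ Finset.range dbar, e (j + 1)
  calc _ ≤ (24 + (12 + 24 * Real.pi) + 24) * (24 * S + (12 + 24 * Real.pi) * S + 24 * S) := by
        gcongr
    _ = (60 + 24 * Real.pi) ^ 2 * S := by ring
    _ ≤ _ := by gcongr; linarith

lemma norm_grad_sub_le (hδ : 0 < δ) (hLf : 0 < Lf) (hm : 0 < m m₁ m₂)
    (x x' : EuclideanSpace ℝ (Fin (m m₁ m₂) × Fin dbar)) :
    ‖grad δ Lf m₁ m₂ x - grad δ Lf m₁ m₂ x'‖ ≤ Lf * ‖x - x'‖ := by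
  refine le_of_sq_le_sq ?_ (by positivity)
  rw [mul_pow, EuclideanSpace.real_norm_sq_eq, EuclideanSpace.real_norm_sq_eq,
    Fintype.sum_prod_type, Fintype.sum_prod_type, Finset.mul_sum]
  refine Finset.sum_le_sum fun i _ => ?_
  set c := innerScale δ Lf m₁ m₂
  set a := outerScale δ Lf m₁ m₂
  have key := sum_slope_sub_sq_le (δ := δ) (Lf := Lf) x x' i
  rw [← Fin.sum_univ_eq_sum_range (fun j =>
      (slope δ Lf m₁ m₂ x i j - slope δ Lf m₁ m₂ x' i j) ^ 2),
    ← Fin.sum_univ_eq_sum_range (fun j =>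
      (scaled δ Lf m₁ m₂ x i (j + 1) - scaled δ Lf m₁ m₂ x' i (j + 1)) ^ 2)] at key
  simp only [scaled_succ] at key
  have e1 : ∑ j : Fin dbar, ((grad δ Lf m₁ m₂ x - grad δ Lf m₁ m₂ x') (i, j)) ^ 2 =
      (a * c) ^ 2 * ∑ j : Fin dbar,
        (slope δ Lf m₁ m₂ x i j - slope δ Lf m₁ m₂ x' i j) ^ 2 := by
    rw [Finset.mul_sum]
    refine Finset.sum_congr rfl fun j _ => ?_
    simp only [grad, PiLp.sub_apply]
    ring
  have e2 : ∑ j : Fin dbar, (c * x (i, j) - c * x' (i, j)) ^ 2 =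
      c ^ 2 * ∑ j : Fin dbar, ((x - x') (i, j)) ^ 2 := by
    rw [Finset.mul_sum]
    refine Finset.sum_congr rfl fun j _ => ?_
    simp only [PiLp.sub_apply]
    ring
  rw [e2] at key
  rw [e1]
  have hL := outerScale_mul_innerScale_sq hδ hLf hm
  calc _ ≤ (a * c) ^ 2 * ((75 * Real.pi) ^ 2 * (c ^ 2 * ∑ j : Fin dbar, ((x - x') (i, j)) ^ 2)) :=
        mul_le_mul_of_nonneg_left key (sq_nonneg _)
    _ = (a * c ^ 2 * (75 * Real.pi)) ^ 2 * ∑ j : Fin dbar, ((x - x') (i, j)) ^ 2 := by ring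
    _ = _ := by rw [hL]

lemma f₀_ge (hδ : 0 < δ) (hLf : 0 < Lf) (hm : 0 < m m₁ m₂) (hd : Odd dbar)
    (x : EuclideanSpace ℝ (Fin (m m₁ m₂) × Fin dbar)) :
    -(1800 * Real.pi ^ 2 * δ ^ 2 * dbar / Lf) ≤ f₀ δ Lf m₁ m₂ dbar x := by
  have h0 : (0 : ℝ) < (m m₁ m₂ : ℕ) := Nat.cast_pos.2 hm
  have ha := outerScale_pos hδ hLf hm
  have := Finset.card_nsmul_le_sum Finset.univ
    (fun i : Fin (m m₁ m₂) => f δ Lf m₁ m₂ ((i : ℕ) + 1) (fun j => x (i, j)))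
    (outerScale δ Lf m₁ m₂ * -(6 * Real.pi * dbar))
    (fun i _ => mul_le_mul_of_nonneg_left (h_ge m₁ m₂ hd _ _) ha.le)
  rw [Finset.card_univ, Fintype.card_fin, nsmul_eq_mul] at this
  refine le_trans (le_of_eq ?_) this
  unfold outerScale
  field_simp
  ring

lemma f₀_zero_nonpos (hδ : 0 < δ) (hLf : 0 < Lf) (hm : 0 < m m₁ m₂) (hd : Odd dbar) :
    f₀ δ Lf m₁ m₂ dbar 0 ≤ 0 := by
  have ha := outerScale_pos hδ hLf hm
  refine Finset.sum_nonpos fun i _ => mul_nonpos_of_nonneg_of_nonpos ha.le ?_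
  have : (√(m m₁ m₂ : ℝ) * Lf / (150 * Real.pi * δ)) •
      (fun j : Fin dbar => (0 : EuclideanSpace ℝ (Fin (m m₁ m₂) × Fin dbar)) (i, j)) = 0 := by
    ext j; simp
  rw [this]
  exact h_zero_nonpos m₁ m₂ hd _

lemma gbar_nonneg {β : ℝ} (hLf : 0 < Lf) (hβ : 0 ≤ β)
    (y : EuclideanSpace ℝ ({k // k ∈ rowsM m₁ m₂} × Fin dbar)) :
    0 ≤ gbar Lf β m₁ m₂ dbar y :=
  mul_nonneg (div_nonneg hβ (by positivity)) (Finset.sum_nonneg fun _ _ => abs_nonneg _)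

lemma convexOn_gbar {β : ℝ} (hLf : 0 < Lf) (hβ : 0 ≤ β) :
    ConvexOn ℝ Set.univ (gbar Lf β m₁ m₂ dbar) := by
  refine ⟨convex_univ, fun x _ y _ a b ha hb _ => ?_⟩
  have hc : 0 ≤ β / ((m m₁ m₂ : ℝ) * Lf) := div_nonneg hβ (by positivity)
  unfold gbar
  have : ∑ k, |(a • x + b • y) k| ≤ a * ∑ k, |x k| + b * ∑ k, |y k| := by
    rw [Finset.mul_sum, Finset.mul_sum, ← Finset.sum_add_distrib]
    refine Finset.sum_le_sum fun k _ => ?_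
    simp only [PiLp.add_apply, PiLp.smul_apply, smul_eq_mul]
    refine (abs_add_le _ _).trans (le_of_eq ?_)
    rw [abs_mul, abs_mul, abs_of_nonneg ha, abs_of_nonneg hb]
  refine (mul_le_mul_of_nonneg_left this hc).trans (le_of_eq ?_)
  simp only [smul_eq_mul]
  ring

lemma continuous_gbar {β : ℝ} : Continuous (gbar Lf β m₁ m₂ dbar) := by
  unfold gbar; fun_prop

lemma F_ge {β : ℝ} (hδ : 0 < δ) (hLf : 0 < Lf) (hm : 0 < m m₁ m₂) (hd : Odd dbar) (hβ : 0 ≤ β)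
    (p : EuclideanSpace ℝ (Fin (m m₁ m₂) × Fin dbar) ×
      EuclideanSpace ℝ ({k // k ∈ rowsM m₁ m₂} × Fin dbar)) :
    -(1800 * Real.pi ^ 2 * δ ^ 2 * dbar / Lf) ≤ (problem δ Lf β m₁ m₂ dbar).F p.1 p.2 := by
  have h1 := f₀_ge hδ hLf hm hd p.1
  have h2 := gbar_nonneg hLf hβ p.2
  change _ ≤ f₀ δ Lf m₁ m₂ dbar p.1 + gbar Lf β m₁ m₂ dbar p.2
  linarith

lemma admissible_problem {β : ℝ} (hδ : 0 < δ) (hLf : 0 < Lf) (hm : 0 < m m₁ m₂) (hd : Odd dbar)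
    (hβ : 0 ≤ β) : (problem δ Lf β m₁ m₂ dbar).Admissible Lf := by
  refine ⟨fun x => (hasGradientAt_f₀ δ Lf m₁ m₂ hd x).differentiableAt, fun x x' => ?_,
    convexOn_gbar hLf hβ, continuous_gbar.lowerSemicontinuous,
    ⟨-(1800 * Real.pi ^ 2 * δ ^ 2 * dbar / Lf), ?_⟩⟩
  · have e := fun x => (hasGradientAt_f₀ δ Lf m₁ m₂ hd x).gradient
    change ‖gradient (f₀ δ Lf m₁ m₂ dbar) x - gradient (f₀ δ Lf m₁ m₂ dbar) x'‖ ≤ _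
    rw [e, e]
    exact norm_grad_sub_le hδ hLf hm x x'
  · rintro _ ⟨p, rfl⟩
    exact F_ge hδ hLf hm hd hβ p

lemma gap_problem_le {β : ℝ} (hδ : 0 < δ) (hLf : 0 < Lf) (hm : 0 < m m₁ m₂) (hd : Odd dbar)
    (hβ : 0 ≤ β) :
    (problem δ Lf β m₁ m₂ dbar).gap 0 0 ≤ 1800 * Real.pi ^ 2 * δ ^ 2 * dbar / Lf := by
  have h1 := le_ciInf (F_ge (m₁ := m₁) (m₂ := m₂) (dbar := dbar) hδ hLf hm hd hβ)
  have h2 := f₀_zero_nonpos (dbar := dbar) hδ hLf hm hd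
  have h3 : (problem δ Lf β m₁ m₂ dbar).F 0 0 = f₀ δ Lf m₁ m₂ dbar 0 := by
    simp [SplitProblem.F, problem, gbar]
  unfold SplitProblem.gap
  rw [h3]
  linarith

end HardInstance

/-! ### Adjoints, Rayleigh quotients and the condition number -/

lemma inner_transpose_mulE {ρ σ : Type*} [Fintype ρ] [Fintype σ] (M : Matrix ρ σ ℝ)
    (w : EuclideanSpace ℝ σ) (y : EuclideanSpace ℝ ρ) :
    inner ℝ w (M.transpose.mulE y) = inner ℝ (M.mulE w) y := by
  simp only [PiLp.inner_apply, Matrix.mulE, Matrix.mulVec, dotProduct, Matrix.transpose_apply,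
    Real.inner_apply, Finset.mul_sum, Finset.sum_mul]
  rw [Finset.sum_comm]
  refine Finset.sum_congr rfl fun r _ => Finset.sum_congr rfl fun i _ => ?_
  ring

/-- Every real eigenvalue of `M Mᵀ` is a Rayleigh quotient. -/
lemma exists_sum_sq_of_mem_spectrum {ρ σ : Type*} [Fintype ρ] [DecidableEq ρ] [Fintype σ]
    {M : Matrix ρ σ ℝ} {μ : ℝ} (hμ : μ ∈ spectrum ℝ (M * M.transpose)) :
    ∃ v : ρ → ℝ, 0 < ∑ r, v r ^ 2 ∧
      ∑ i, (M.transpose.mulVec v i) ^ 2 = μ * ∑ r, v r ^ 2 := by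
  rw [← Matrix.spectrum_toLin', ← Module.End.hasEigenvalue_iff_mem_spectrum] at hμ
  obtain ⟨v, hv⟩ := hμ.exists_hasEigenvector
  have hv1 := hv.apply_eq_smul
  have hv0 := hv.2
  refine ⟨v, ?_, ?_⟩
  · obtain ⟨r, hr⟩ := Function.ne_iff.1 hv0
    have hr' : v r ≠ 0 := hr
    exact Finset.sum_pos' (fun _ _ => sq_nonneg _) ⟨r, Finset.mem_univ _, by positivity⟩
  · rw [Matrix.toLin'_apply, ← Matrix.mulVec_mulVec] at hv1
    have h1 : v ⬝ᵥ (M.mulVec (M.transpose.mulVec v)) = v ⬝ᵥ (μ • v) := by rw [hv1]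
    rw [Matrix.dotProduct_mulVec, ← Matrix.mulVec_transpose, dotProduct_smul] at h1
    simpa [dotProduct, sq] using h1

/-- Bounds of the Rayleigh quotients of `M Mᵀ` bound the condition number of `M`. -/
lemma condNumber_le {ρ σ : Type*} [Fintype ρ] [DecidableEq ρ] [Fintype σ] {M : Matrix ρ σ ℝ}
    {a b K : ℝ} (ha : 0 < a) (hK : 0 ≤ K) (hab : b ≤ K ^ 2 * a)
    (hlo : ∀ v : ρ → ℝ, a * ∑ r, v r ^ 2 ≤ ∑ i, (M.transpose.mulVec v i) ^ 2)
    (hup : ∀ v : ρ → ℝ, ∑ i, (M.transpose.mulVec v i) ^ 2 ≤ b * ∑ r, v r ^ 2) :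
    M.condNumber ≤ K := by
  unfold Matrix.condNumber
  -- For an empty spectrum `sSup` and `sInf` are both `0` by convention, and the quotient `0 / 0` is
  -- `0`.
  rcases (spectrum ℝ (M * M.transpose)).eq_empty_or_nonempty with he | hne
  · simpa [he] using hK
  have h1 : a ≤ sInf (spectrum ℝ (M * M.transpose)) := le_csInf hne fun μ hμ => by
    obtain ⟨v, hv, e⟩ := exists_sum_sq_of_mem_spectrum hμ
    have := hlo v
    rw [e] at this
    exact le_of_mul_le_mul_right this hv
  have h2 : sSup (spectrum ℝ (M * M.transpose)) ≤ b := csSup_le hne fun μ hμ => by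
    obtain ⟨v, hv, e⟩ := exists_sum_sq_of_mem_spectrum hμ
    have := hup v
    rw [e] at this
    exact le_of_mul_le_mul_right this hv
  rw [← Real.sqrt_sq hK]
  refine Real.sqrt_le_sqrt ?_
  rw [div_le_iff₀ (ha.trans_le h1)]
  exact h2.trans (hab.trans (mul_le_mul_of_nonneg_left h1 (sq_nonneg K)))

/-- Telescoping and Cauchy–Schwarz. It serves twice: for the smallest eigenvalue of `J Jᵀ`, and for
the closeness of the blocks at a stationary point. -/
lemma sq_sub_le_mul_sum_sq_sub (W : ℕ → ℝ) {k n : ℕ} (hk : k ≤ n) :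
    (W k - W 0) ^ 2 ≤ n * ∑ i ∈ Finset.range n, (W (i + 1) - W i) ^ 2 := by
  rw [← Finset.sum_range_sub W k]
  refine sq_sum_le_card_mul_sum_sq.trans ?_
  rw [Finset.card_range]
  gcongr

namespace HardInstance

/-- The rows of `J_p ⊗ I` selected by `e`, multiplied by `c`. -/
noncomputable def diffMat {ρ : Type*} (p dbar : ℕ) (c : ℝ) (e : ρ → Fin (p - 1)) :
    Matrix (ρ × Fin dbar) (Fin p × Fin dbar) ℝ :=
  c • ((J p).submatrix e id ⊗ₖ (1 : Matrix (Fin dbar) (Fin dbar) ℝ))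

lemma A_eq_diffMat (Lf : ℝ) (m₁ m₂ dbar : ℕ) :
    A Lf m₁ m₂ dbar = diffMat (m m₁ m₂) dbar ((m m₁ m₂ : ℝ) * Lf) Subtype.val := rfl

lemma Abar_eq_diffMat (Lf : ℝ) (m₁ m₂ dbar : ℕ) :
    Abar Lf m₁ m₂ dbar = diffMat (m m₁ m₂) dbar ((m m₁ m₂ : ℝ) * Lf) Subtype.val := rfl

variable {p dbar : ℕ}

/-- The block on the left of the row `k` of `J_p`. -/
def leftBlock (k : Fin (p - 1)) : Fin p := ⟨k, by omega⟩

/-- The block on the right of the row `k` of `J_p`. -/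
def rightBlock (k : Fin (p - 1)) : Fin p := ⟨k + 1, by omega⟩

lemma J_apply_left (k : Fin (p - 1)) : J p k (leftBlock k) = -1 := by simp [J, leftBlock]

lemma J_apply_right (k : Fin (p - 1)) : J p k (rightBlock k) = 1 := by simp [J, rightBlock]

lemma J_apply_of_ne {k : Fin (p - 1)} {i : Fin p} (h1 : i ≠ leftBlock k) (h2 : i ≠ rightBlock k) :
    J p k i = 0 := by
  simp only [ne_eq, Fin.ext_iff, leftBlock, rightBlock] at h1 h2
  simp [J, h1, h2]

lemma leftBlock_ne_rightBlock (k : Fin (p - 1)) : leftBlock k ≠ rightBlock k := by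
  simp [leftBlock, rightBlock]

lemma sum_J_mul (k : Fin (p - 1)) (g : Fin p → ℝ) :
    ∑ i, J p k i * g i = g (rightBlock k) - g (leftBlock k) := by
  rw [Fintype.sum_eq_add (leftBlock k) (rightBlock k) (leftBlock_ne_rightBlock k)
    (fun i hi => by rw [J_apply_of_ne hi.1 hi.2, zero_mul]), J_apply_left, J_apply_right]
  ring

lemma diffMat_mulE_apply {ρ : Type*} (c : ℝ) (e : ρ → Fin (p - 1))
    (x : EuclideanSpace ℝ (Fin p × Fin dbar)) (r : ρ) (j : Fin dbar) :
    (diffMat p dbar c e).mulE x (r, j) =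
      c * (x (rightBlock (e r), j) - x (leftBlock (e r), j)) := by
  rw [← sum_J_mul (e r) fun i => x (i, j), Finset.mul_sum]
  simp only [Matrix.mulE, Matrix.mulVec, dotProduct, diffMat, Fintype.sum_prod_type]
  refine Finset.sum_congr rfl fun i _ => ?_
  rw [Finset.sum_eq_single j]
  · simp [mul_assoc]
  · intro j' _ hj'
    simp [Matrix.one_apply_ne' hj']
  · simp

lemma diffMat_transpose_mulVec {ρ : Type*} [Fintype ρ] (c : ℝ) (e : ρ → Fin (p - 1))
    (y : ρ × Fin dbar → ℝ) (i : Fin p) (j : Fin dbar) :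
    (diffMat p dbar c e).transpose.mulVec y (i, j) = c * ∑ r, J p (e r) i * y (r, j) := by
  rw [Finset.mul_sum]
  simp only [Matrix.mulVec, dotProduct, diffMat, Fintype.sum_prod_type, Matrix.transpose_apply]
  refine Finset.sum_congr rfl fun i _ => ?_
  rw [Finset.sum_eq_single j]
  · simp [mul_assoc]
  · intro j' _ hj'
    simp [Matrix.one_apply_ne hj']
  · simp

lemma diffMat_transpose_mulE_apply {ρ : Type*} [Fintype ρ] (c : ℝ) (e : ρ → Fin (p - 1))
    (y : EuclideanSpace ℝ (ρ × Fin dbar)) (i : Fin p) (j : Fin dbar) :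
    (diffMat p dbar c e).transpose.mulE y (i, j) = c * ∑ r, J p (e r) i * y (r, j) :=
  diffMat_transpose_mulVec c e _ i j

lemma coord_eq_sum {n : ℕ} (w : Fin n → ℝ) (l : ℕ) :
    coord w l = ∑ k : Fin n, if l = (k : ℕ) + 1 then w k else 0 := by
  unfold coord
  split_ifs with h
  · rw [Finset.sum_eq_single ⟨l - 1, by omega⟩]
    · rw [if_pos (by simp; omega)]
    · intro k _ hk
      rw [if_neg]
      rintro rfl
      exact hk (by simp)
    · simp
  · refine (Finset.sum_eq_zero fun k _ => ?_).symm
    rw [if_neg (by omega)]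

/-- `Jᵀ w` is the sequence of differences of `w` padded by a zero at both ends, which is what the
value `0` of `coord` outside its range provides. -/
lemma sum_J_mul_rows (w : Fin (p - 1) → ℝ) (i : Fin p) :
    ∑ k, J p k i * w k = coord w i - coord w (i + 1) := by
  rw [coord_eq_sum, coord_eq_sum, ← Finset.sum_sub_distrib]
  refine Finset.sum_congr rfl fun k _ => ?_
  simp only [J, Matrix.of_apply, Nat.add_right_cancel_iff]
  split_ifs with h1 h2 h3 <;> first | omega | simp

lemma sum_coord_sq (w : Fin (p - 1) → ℝ) (hp : 0 < p) :
    ∑ k ∈ Finset.range p, coord w k ^ 2 = ∑ k, w k ^ 2 ∧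
      ∑ k ∈ Finset.range p, coord w (k + 1) ^ 2 = ∑ k, w k ^ 2 := by
  obtain ⟨q, rfl⟩ : ∃ q, p = q + 1 := ⟨p - 1, by omega⟩
  have h0 : coord w 0 = 0 := by simp [coord]
  have h1 : coord w (q + 1) = 0 := by simp [coord]
  have h2 : ∑ k ∈ Finset.range q, coord w (k + 1) ^ 2 = ∑ k, w k ^ 2 := by
    rw [← Fin.sum_univ_eq_sum_range (fun k => coord w (k + 1) ^ 2) q]
    refine Finset.sum_congr rfl fun k _ => ?_
    rw [show coord w ((k : ℕ) + 1) = w k from coord_succ w k]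
  constructor
  · rw [Finset.sum_range_succ', h2, h0]; simp
  · rw [Finset.sum_range_succ, h2, h1]; simp

lemma sum_J_mul_rows_sq_le (w : Fin (p - 1) → ℝ) (hp : 0 < p) :
    ∑ i, (∑ k, J p k i * w k) ^ 2 ≤ 4 * ∑ k, w k ^ 2 := by
  obtain ⟨h1, h2⟩ := sum_coord_sq w hp
  simp_rw [sum_J_mul_rows]
  rw [Fin.sum_univ_eq_sum_range (fun i => (coord w i - coord w (i + 1)) ^ 2)]
  calc _ ≤ ∑ i ∈ Finset.range p, (2 * coord w i ^ 2 + 2 * coord w (i + 1) ^ 2) :=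
        Finset.sum_le_sum fun i _ => by nlinarith [sq_nonneg (coord w i + coord w (i + 1))]
    _ = _ := by rw [Finset.sum_add_distrib, ← Finset.mul_sum, ← Finset.mul_sum, h1, h2]; ring

/-- A discrete Poincaré inequality: the padded sequence starts at `0`, so each squared entry is at
most `p` times the energy, and there are `p` entries to add. -/
lemma sum_sq_le_sum_J_mul_rows_sq (w : Fin (p - 1) → ℝ) (hp : 0 < p) :
    ∑ k, w k ^ 2 ≤ (p : ℝ) ^ 2 * ∑ i, (∑ k, J p k i * w k) ^ 2 := by
  obtain ⟨h1, -⟩ := sum_coord_sq w hp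
  have h0 : coord w 0 = 0 := by simp [coord]
  simp_rw [sum_J_mul_rows]
  rw [Fin.sum_univ_eq_sum_range (fun i => (coord w i - coord w (i + 1)) ^ 2), ← h1]
  refine (Finset.sum_le_card_nsmul (Finset.range p) _
    (p * ∑ i ∈ Finset.range p, (coord w (i + 1) - coord w i) ^ 2) fun k hk => ?_).trans
      (le_of_eq ?_)
  · have := sq_sub_le_mul_sum_sq_sub (coord w) (Finset.mem_range.1 hk).le
    rwa [h0, sub_zero] at this
  · rw [Finset.card_range, nsmul_eq_mul, ← mul_assoc, ← sq]
    congr 1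
    exact Finset.sum_congr rfl fun i _ => by ring

/-- The rows of `[Ā; A]` are those of `J_m ⊗ I`, up to the order. -/
noncomputable def rowEquiv (s : Finset (Fin (p - 1))) (dbar : ℕ) :
    ({k // k ∈ s} × Fin dbar) ⊕ ({k // k ∈ sᶜ} × Fin dbar) ≃ Fin (p - 1) × Fin dbar :=
  Equiv.ofBijective (Sum.elim (fun q => (q.1.1, q.2)) fun q => (q.1.1, q.2)) <| by
    constructor
    · rintro (⟨⟨k, hk⟩, j⟩ | ⟨⟨k, hk⟩, j⟩) (⟨⟨k', hk'⟩, j'⟩ | ⟨⟨k', hk'⟩, j'⟩) h <;>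
        simp only [Sum.elim_inl, Sum.elim_inr, Prod.mk.injEq] at h <;>
        obtain ⟨rfl, rfl⟩ := h
      · rfl
      · exact absurd hk (Finset.mem_compl.1 hk')
      · exact absurd hk' (Finset.mem_compl.1 hk)
      · rfl
    · rintro ⟨k, j⟩
      by_cases hk : k ∈ s
      · exact ⟨Sum.inl (⟨k, hk⟩, j), rfl⟩
      · exact ⟨Sum.inr (⟨k, Finset.mem_compl.2 hk⟩, j), rfl⟩

lemma sum_rows_eq (s : Finset (Fin (p - 1))) (g : Fin (p - 1) × Fin dbar → ℝ) :
    ∑ q : {k // k ∈ s} × Fin dbar, g (q.1, q.2) + ∑ q : {k // k ∈ sᶜ} × Fin dbar, g (q.1, q.2) =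
      ∑ q, g q := by
  rw [← (rowEquiv s dbar).sum_comp, Fintype.sum_sum_type]
  rfl

lemma condNumber_fromRows_le {c : ℝ} (hc : 0 < c) (hp : 0 < p) (s : Finset (Fin (p - 1))) :
    (Matrix.fromRows (diffMat p dbar c (Subtype.val : {k // k ∈ s} → _))
      (diffMat p dbar c (Subtype.val : {k // k ∈ sᶜ} → _))).condNumber ≤ 2 * p := by
  have hp0 : (0 : ℝ) < p := Nat.cast_pos.2 hp
  set M := Matrix.fromRows (diffMat p dbar c (Subtype.val : {k // k ∈ s} → _))
      (diffMat p dbar c (Subtype.val : {k // k ∈ sᶜ} → _)) with hM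
  have hMT : ∀ (v : ({k // k ∈ s} × Fin dbar) ⊕ ({k // k ∈ sᶜ} × Fin dbar) → ℝ) i j,
      M.transpose.mulVec v (i, j) =
        c * ∑ k, J p k i * v ((rowEquiv s dbar).symm (k, j)) := fun v i j => by
    have h1 : M.transpose.mulVec v =
        (diffMat p dbar c (id : Fin (p - 1) → _)).transpose.mulVec
          (v ∘ (rowEquiv s dbar).symm) := by
      funext q
      simp only [Matrix.mulVec, dotProduct, Matrix.transpose_apply]
      rw [← (rowEquiv s dbar).sum_comp]
      refine Finset.sum_congr rfl fun r _ => ?_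
      rcases r with r | r <;> simp [hM] <;> left <;> rfl
    rw [h1, diffMat_transpose_mulVec]
    rfl
  have hsq : ∀ v : ({k // k ∈ s} × Fin dbar) ⊕ ({k // k ∈ sᶜ} × Fin dbar) → ℝ,
      ∑ q, (M.transpose.mulVec v q) ^ 2 =
        c ^ 2 * ∑ j, ∑ i, (∑ k, J p k i * v ((rowEquiv s dbar).symm (k, j))) ^ 2 := fun v => by
    rw [Fintype.sum_prod_type, Finset.sum_comm]
    simp_rw [hMT, mul_pow, Finset.mul_sum]
  have hv : ∀ v : ({k // k ∈ s} × Fin dbar) ⊕ ({k // k ∈ sᶜ} × Fin dbar) → ℝ,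
      ∑ q, v q ^ 2 = ∑ j, ∑ k, v ((rowEquiv s dbar).symm (k, j)) ^ 2 := fun v => by
    rw [← (rowEquiv s dbar).symm.sum_comp, Fintype.sum_prod_type, Finset.sum_comm]
  -- The eigenvalues lie in `[c² / p², 4 c²]`, and the square root of the ratio of the endpoints is
  -- `2p`.
  refine condNumber_le (a := c ^ 2 / p ^ 2) (b := c ^ 2 * 4) (by positivity) (by positivity)
    (le_of_eq (by field_simp; norm_num)) (fun v => ?_) (fun v => ?_)
  · rw [hsq, hv, div_mul_eq_mul_div, mul_div_assoc]
    refine mul_le_mul_of_nonneg_left ?_ (by positivity)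
    rw [div_le_iff₀ (by positivity), mul_comm, Finset.mul_sum]
    exact Finset.sum_le_sum fun j _ => sum_sq_le_sum_J_mul_rows_sq _ hp
  · rw [hsq, hv, mul_assoc]
    refine mul_le_mul_of_nonneg_left ?_ (by positivity)
    rw [Finset.mul_sum]
    exact Finset.sum_le_sum fun j _ => sum_J_mul_rows_sq_le _ hp

lemma jointCond_problem_le {δ Lf β : ℝ} {m₁ m₂ : ℕ} (hLf : 0 < Lf) (hm : 0 < m m₁ m₂) :
    (problem δ Lf β m₁ m₂ dbar).jointCond ≤ 2 * (m m₁ m₂ : ℕ) := by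
  have : (0 : ℝ) < (m m₁ m₂ : ℕ) := Nat.cast_pos.2 hm
  exact condNumber_fromRows_le (by positivity) hm (rowsM m₁ m₂)

end HardInstance

/-! ### Propagation of supports along the iterations -/

/-- The vectors that vanish on the set `S` of coordinates. -/
def vanishing {ι : Type*} (S : Set ι) : Submodule ℝ (EuclideanSpace ℝ ι) where
  carrier := {x | ∀ i ∈ S, x i = 0}
  add_mem' {x y} hx hy i hi := by simp [hx i hi, hy i hi]
  zero_mem' i _ := by simp
  smul_mem' c x hx i hi := by simp [hx i hi]

lemma vanishing_anti {ι : Type*} {S S' : Set ι} (h : S ⊆ S') : vanishing S' ≤ vanishing S :=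
  fun _ hx i hi => hx i (h hi)

/-- The vector `y` with the coordinate `k` replaced by `0`. -/
def zeroAt {ι : Type*} [DecidableEq ι] (y : EuclideanSpace ℝ ι) (k : ι) : EuclideanSpace ℝ ι :=
  WithLp.toLp 2 fun i => if i = k then 0 else y i

lemma sum_abs_zeroAt {ι : Type*} [Fintype ι] [DecidableEq ι] (y : EuclideanSpace ℝ ι) (k : ι) :
    ∑ i, |zeroAt y k i| = ∑ i, |y i| - |y k| := by
  have : ∀ i, |zeroAt y k i| = |y i| - if i = k then |y i| else 0 := fun i => by
    by_cases h : i = k <;> simp [zeroAt, h]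
  simp [this, Finset.sum_sub_distrib]

namespace HardInstance

/-- The position of the block `i` (counted from `0`) relative to the middle third. -/
def middlePos (N : ℕ) (i : ℕ) : ℤ := min (max ((i : ℤ) + 1 - N) 0) N

/-- A lower bound for the first iteration in which the coordinate `j` of the block `i` (both counted
from `0`) can be nonzero. -/
def activation (N : ℕ) (i j : ℕ) : ℤ :=
  ((j : ℤ) - 1) * N + if Odd j then middlePos N i else N - middlePos N i

/-- `middlePos` changes by at most one from block to block; with `activation_le_succ` this says that
information moves by at most one block per call. -/
lemma activation_succ_le (N i j : ℕ) : activation N (i + 1) j ≤ activation N i j + 1 := by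
  unfold activation middlePos
  generalize ((j : ℤ) - 1) * N = a
  push_cast
  split_ifs <;> omega

lemma activation_le_succ (N i j : ℕ) : activation N i j ≤ activation N (i + 1) j + 1 := by
  unfold activation middlePos
  generalize ((j : ℤ) - 1) * N = a
  push_cast
  split_ifs <;> omega

lemma activation_zero_nonpos (N i : ℕ) : activation N i 0 ≤ 0 := by
  simp only [activation, middlePos]
  rw [if_neg (by decide)]
  push_cast
  omega

/-- Odd `j` (counted from `0`) are switched on in the first third and travel right, even `j` in the
last third and travel left. The hypothesis selects the third holding the link from `j` to `j + 1`;
there the wave of `j` has just arrived, and both activation times equal `j * N`. -/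
lemma activation_step {N i j : ℕ}
    (h : (i + 1 ≤ N ∧ Odd (j + 1)) ∨ (2 * N < i + 1 ∧ Even (j + 1))) :
    activation N i (j + 1) ≤ activation N i j + 1 := by
  unfold activation middlePos
  have e : (((j + 1 : ℕ) : ℤ) - 1) * N = ((j : ℤ) - 1) * N + N := by push_cast; ring
  rw [e]
  generalize ((j : ℤ) - 1) * N = a
  rcases h with ⟨h1, h2⟩ | ⟨h1, h2⟩
  · have h3 : ¬ Odd j := fun hj => by
      rw [Nat.odd_add_one] at h2; exact h2 hj
    rw [if_pos h2, if_neg h3]; omega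
  · have h3 : Odd j := by
      by_contra hj
      rw [Nat.even_add_one] at h2
      exact h2 (Nat.not_odd_iff_even.1 hj)
    rw [if_neg (Nat.not_odd_iff_even.2 h2), if_pos h3]; omega

variable {p dbar : ℕ}

/-- The vectors whose nonzero coordinates have been activated at the time `τ`. -/
def activeX (N p dbar : ℕ) (τ : ℤ) : Submodule ℝ (EuclideanSpace ℝ (Fin p × Fin dbar)) :=
  vanishing {q | τ < activation N q.1 q.2}

/-- The counterpart of `activeX` for the differences of neighbouring blocks. -/
def activeY {ρ : Type*} (N dbar : ℕ) (e : ρ → Fin (p - 1)) (τ : ℤ) :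
    Submodule ℝ (EuclideanSpace ℝ (ρ × Fin dbar)) :=
  vanishing {q | τ < activation N (e q.1) q.2 ∨ τ < activation N (e q.1 + 1) q.2}

lemma activeX_mono (N : ℕ) {τ τ' : ℤ} (h : τ ≤ τ') : activeX N p dbar τ ≤ activeX N p dbar τ' :=
  vanishing_anti fun _ hq => lt_of_le_of_lt h hq

lemma activeY_mono {ρ : Type*} (N : ℕ) (e : ρ → Fin (p - 1)) {τ τ' : ℤ} (h : τ ≤ τ') :
    activeY N dbar e τ ≤ activeY N dbar e τ' :=
  vanishing_anti fun _ hq => hq.imp (lt_of_le_of_lt h) (lt_of_le_of_lt h)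

lemma diffMat_mulE_mem {ρ : Type*} {N : ℕ} (c : ℝ) (e : ρ → Fin (p - 1)) {τ : ℤ}
    {x : EuclideanSpace ℝ (Fin p × Fin dbar)} (hx : x ∈ activeX N p dbar τ) :
    (diffMat p dbar c e).mulE x ∈ activeY N dbar e (τ + 1) := by
  rintro ⟨r, j⟩ hq
  have h1 := activation_succ_le N (e r) j
  have h2 := activation_le_succ N (e r) j
  simp only [Set.mem_ofPred_eq] at hq
  rw [diffMat_mulE_apply, hx (rightBlock (e r), j), hx (leftBlock (e r), j)]
  · simp
  · simp only [Set.mem_ofPred_eq, leftBlock]; omega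
  · simp only [Set.mem_ofPred_eq, rightBlock]; omega

/-- No time is lost here: `activeY` already requires both blocks adjacent to a row to be active. The
unit delay is charged to `diffMat_mulE_mem` alone, so `MᵀM` and `MMᵀ` each cost one call. -/
lemma diffMat_transpose_mulE_mem {ρ : Type*} [Fintype ρ] {N : ℕ} (c : ℝ) (e : ρ → Fin (p - 1))
    {τ : ℤ} {y : EuclideanSpace ℝ (ρ × Fin dbar)} (hy : y ∈ activeY N dbar e τ) :
    (diffMat p dbar c e).transpose.mulE y ∈ activeX N p dbar τ := by
  rintro ⟨i, j⟩ hq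
  simp only [Set.mem_ofPred_eq] at hq
  rw [diffMat_transpose_mulE_apply, Finset.sum_eq_zero, mul_zero]
  intro r _
  by_cases h1 : i = leftBlock (e r)
  · subst h1
    rw [hy (r, j) (Or.inl hq), mul_zero]
  · by_cases h2 : i = rightBlock (e r)
    · subst h2
      rw [hy (r, j) (Or.inr hq), mul_zero]
    · rw [J_apply_of_ne h1 h2, zero_mul]

lemma grad_mem {δ Lf : ℝ} {m₁ m₂ : ℕ} {τ : ℤ} (hτ : 0 ≤ τ)
    {x : EuclideanSpace ℝ (Fin (m m₁ m₂) × Fin dbar)}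
    (hx : x ∈ activeX (m₁ * m₂) (m m₁ m₂) dbar τ) :
    grad δ Lf m₁ m₂ x ∈ activeX (m₁ * m₂) (m m₁ m₂) dbar (τ + 1) := by
  rintro ⟨i, j⟩ hq
  simp only [Set.mem_ofPred_eq] at hq
  have h1 : scaled δ Lf m₁ m₂ x i ((j : ℕ) + 1) = 0 := by
    rw [scaled_succ, hx (i, j) (by simp only [Set.mem_ofPred_eq]; omega), mul_zero]
  have h2 : weight m₁ m₂ dbar ((i : ℕ) + 1) j *
      linkSnd (scaled δ Lf m₁ m₂ x i j) (scaled δ Lf m₁ m₂ x i ((j : ℕ) + 1)) = 0 := by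
    by_cases hw : weight m₁ m₂ dbar ((i : ℕ) + 1) j = 0
    · rw [hw, zero_mul]
    have hj0 : (j : ℕ) ≠ 0 := fun h0 => by
      have := activation_zero_nonpos (m₁ * m₂) i
      rw [h0] at hq
      omega
    obtain ⟨l, hl⟩ := Nat.exists_eq_add_one_of_ne_zero hj0
    have hl' : l < dbar := by have := j.2; omega
    have hcase : ((i : ℕ) + 1 ≤ m₁ * m₂ ∧ Odd (l + 1)) ∨
        (2 * (m₁ * m₂) < (i : ℕ) + 1 ∧ Even (l + 1)) := by
      by_contra hc
      refine hw ?_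
      unfold weight
      rw [if_neg (by have := j.2; omega), if_neg hj0, hl, if_neg hc]
    have hstep := activation_step hcase
    have h3 : scaled δ Lf m₁ m₂ x i (l + 1) = 0 := by
      have := scaled_succ δ Lf m₁ m₂ x i ⟨l, hl'⟩
      rw [hx (i, ⟨l, hl'⟩) (by simp only [Set.mem_ofPred_eq]; rw [hl] at hq; omega), mul_zero] at this
      exact this
    rw [show (j : ℕ) = l + 1 from hl, h3, linkSnd_zero, mul_zero]
  change -(outerScale δ Lf m₁ m₂ * innerScale δ Lf m₁ m₂ * slope δ Lf m₁ m₂ x i j) = 0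
  unfold slope
  rw [h2, h1, linkFst_zero]
  simp

/-- If `ξ k = 0`, setting the entry `k` of `ζ` to zero does not increase the ℓ¹ norm and lowers the
quadratic term by a multiple of `ζ k ^ 2`. -/
lemma apply_eq_zero_of_isProx {Lf β η : ℝ} {m₁ m₂ : ℕ} (hLf : 0 < Lf) (hβ : 0 ≤ β) (hη : 0 < η)
    {ξ ζ : EuclideanSpace ℝ ({k // k ∈ rowsM m₁ m₂} × Fin dbar)}
    (h : IsProx (gbar Lf β m₁ m₂ dbar) η ξ ζ) {k : {k // k ∈ rowsM m₁ m₂} × Fin dbar}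
    (hk : ξ k = 0) : ζ k = 0 := by
  have h1 := h (zeroAt ζ k)
  have hc : 0 ≤ β / ((m m₁ m₂ : ℝ) * Lf) := div_nonneg hβ (by positivity)
  have h2 : ‖zeroAt ζ k - ξ‖ ^ 2 = ‖ζ - ξ‖ ^ 2 - ζ k ^ 2 := by
    rw [EuclideanSpace.real_norm_sq_eq, EuclideanSpace.real_norm_sq_eq]
    have : ∀ i, (zeroAt ζ k - ξ) i ^ 2 = (ζ - ξ) i ^ 2 - if i = k then ζ i ^ 2 else 0 := fun i => by
      by_cases hi : i = k
      · subst hi; simp [zeroAt, hk]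
      · simp [zeroAt, hi]
    simp_rw [this]
    rw [Finset.sum_sub_distrib, Finset.sum_ite_eq' Finset.univ k, if_pos (Finset.mem_univ k)]
  unfold gbar at h1
  rw [sum_abs_zeroAt, h2] at h1
  have h3 : 0 ≤ β / ((m m₁ m₂ : ℝ) * Lf) * |ζ k| := mul_nonneg hc (abs_nonneg _)
  have h4 : 1 / (2 * η) * ζ k ^ 2 ≤ 0 := by nlinarith
  have h5 : 0 < 1 / (2 * η) := by positivity
  have h6 : ζ k ^ 2 ≤ 0 := by
    by_contra hcon
    exact absurd h4 (not_le.2 (mul_pos h5 (not_le.1 hcon)))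
  exact pow_eq_zero_iff (two_ne_zero) |>.1 (le_antisymm h6 (sq_nonneg _))

lemma linearSpan_mem {δ Lf β : ℝ} {m₁ m₂ : ℕ} (hLf : 0 < Lf) (hβ : 0 ≤ β) (hd : Odd dbar)
    {x : ℕ → EuclideanSpace ℝ (Fin (m m₁ m₂) × Fin dbar)}
    {y : ℕ → EuclideanSpace ℝ ({k // k ∈ rowsM m₁ m₂} × Fin dbar)} (hx0 : x 0 = 0) (hy0 : y 0 = 0)
    (h : (problem δ Lf β m₁ m₂ dbar).LinearSpan x y) (t : ℕ) :
    x t ∈ activeX (m₁ * m₂) (m m₁ m₂) dbar t ∧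
      y t ∈ activeY (m₁ * m₂) dbar (Subtype.val : {k // k ∈ rowsM m₁ m₂} → _) t := by
  induction t using Nat.strong_induction_on with
  | _ t ih =>
    rcases Nat.eq_zero_or_pos t with rfl | ht
    · rw [hx0, hy0]; exact ⟨zero_mem _, zero_mem _⟩
    obtain ⟨hx, ξ, ζ, hξ, ⟨η, hη, hprox⟩, hy⟩ := h t ht
    have hA : (problem δ Lf β m₁ m₂ dbar).A =
      diffMat (m m₁ m₂) dbar ((m m₁ m₂ : ℝ) * Lf) Subtype.val := rfl
    have hAbar : (problem δ Lf β m₁ m₂ dbar).Abar =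
      diffMat (m m₁ m₂) dbar ((m m₁ m₂ : ℝ) * Lf) Subtype.val := rfl
    have hg : ∀ x, gradient (problem δ Lf β m₁ m₂ dbar).f₀ x = grad δ Lf m₁ m₂ x :=
      fun x => (hasGradientAt_f₀ δ Lf m₁ m₂ hd x).gradient
    have hb : (problem δ Lf β m₁ m₂ dbar).b = 0 := rfl
    have hbbar : (problem δ Lf β m₁ m₂ dbar).bbar = 0 := rfl
    simp only [hg, hA, hAbar, hb, hbbar] at hx hξ
    have hle : ∀ s ∈ Set.Iio t, (s : ℤ) + 1 ≤ t := fun s hs => by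
      have := Set.mem_Iio.1 hs; omega
    have hle' : ∀ s ∈ Set.Iio t, (s : ℤ) ≤ t := fun s hs => by
      have := hle s hs; omega
    have hξ' : ξ ∈ activeY (m₁ * m₂) dbar (Subtype.val : {k // k ∈ rowsM m₁ m₂} → _) (t : ℤ) := by
      refine Submodule.span_le.2 ?_ hξ
      refine Set.union_subset (Set.singleton_subset_iff.2 (zero_mem _)) (Set.iUnion₂_subset ?_)
      rintro s hs z (rfl | rfl | rfl)
      · exact activeY_mono _ _ (hle' s hs) (ih s hs).2
      · exact activeY_mono _ _ (hle s hs)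
          (diffMat_mulE_mem _ _ (diffMat_transpose_mulE_mem _ _ (ih s hs).2))
      · exact activeY_mono _ _ (hle s hs) (diffMat_mulE_mem _ _ (ih s hs).1)
    have hζ : ζ ∈ activeY (m₁ * m₂) dbar (Subtype.val : {k // k ∈ rowsM m₁ m₂} → _) (t : ℤ) :=
      fun k hk => apply_eq_zero_of_isProx hLf hβ hη hprox (hξ' k hk)
    constructor
    · refine Submodule.span_le.2 ?_ hx
      refine Set.union_subset ?_ (Set.iUnion₂_subset ?_)
      · rintro z (rfl | rfl)
        · exact diffMat_transpose_mulE_mem _ _ (zero_mem _)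
        · exact diffMat_transpose_mulE_mem _ _ (zero_mem _)
      · rintro s hs z (rfl | rfl | rfl | rfl | rfl)
        · exact activeX_mono _ (hle' s hs) (ih s hs).1
        · exact activeX_mono _ (hle s hs) (grad_mem (by positivity) (ih s hs).1)
        · exact activeX_mono _ (hle s hs)
            (diffMat_transpose_mulE_mem _ _ (diffMat_mulE_mem _ _ (ih s hs).1))
        · exact activeX_mono _ (hle s hs)
            (diffMat_transpose_mulE_mem _ _ (diffMat_mulE_mem _ _ (ih s hs).1))
        · exact activeX_mono _ (hle' s hs) (diffMat_transpose_mulE_mem _ _ (ih s hs).2)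
    · refine Submodule.span_le.2 ?_ hy
      rintro z (rfl | rfl)
      · exact hξ'
      · exact hζ

end HardInstance

/-! ### Stationary points have no vanishing coordinate in the first block -/

namespace HardInstance

variable {p dbar : ℕ} {δ Lf β ε : ℝ} {m₁ m₂ : ℕ}

/-- Compare `y` with the point obtained by zeroing its entry `k` in the subgradient inequality. -/
lemma le_abs_of_mem_convexSubdiff (y v : EuclideanSpace ℝ ({k // k ∈ rowsM m₁ m₂} × Fin dbar))
    (hv : v ∈ convexSubdiff (gbar Lf β m₁ m₂ dbar) y) {k : {k // k ∈ rowsM m₁ m₂} × Fin dbar}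
    (hk : y k ≠ 0) : β / ((m m₁ m₂ : ℝ) * Lf) ≤ |v k| := by
  have h1 := hv (zeroAt y k)
  have h2 : inner ℝ v (zeroAt y k - y) = -(v k * y k) := by
    rw [PiLp.inner_apply]
    have : ∀ i, inner ℝ (v i) ((zeroAt y k - y) i) = if i = k then -(v i * y i) else 0 := fun i => by
      by_cases hi : i = k
      · subst hi; simp [zeroAt, mul_comm]
      · simp [zeroAt, hi]
    simp_rw [this]
    rw [Finset.sum_ite_eq' Finset.univ k, if_pos (Finset.mem_univ k)]
  unfold gbar at h1
  rw [sum_abs_zeroAt, h2] at h1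
  have h3 : β / ((m m₁ m₂ : ℝ) * Lf) * |y k| ≤ |v k| * |y k| := by
    rw [← abs_mul]; linarith [le_abs_self (v k * y k)]
  exact le_of_mul_le_mul_right h3 (abs_pos.2 hk)

/-- The vector with the entry `χ i` at the coordinate `j` of the block `i`. -/
noncomputable def blockVec (χ : Fin p → ℝ) (j : Fin dbar) : EuclideanSpace ℝ (Fin p × Fin dbar) :=
  WithLp.toLp 2 fun q => if q.2 = j then χ q.1 else 0

lemma inner_blockVec (χ : Fin p → ℝ) (j : Fin dbar) (v : EuclideanSpace ℝ (Fin p × Fin dbar)) :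
    inner ℝ (blockVec χ j) v = ∑ i, χ i * v (i, j) := by
  rw [PiLp.inner_apply, Fintype.sum_prod_type]
  refine Finset.sum_congr rfl fun i _ => ?_
  rw [Finset.sum_eq_single j]
  · simp [blockVec, mul_comm]
  · intro j' _ hj'
    simp [blockVec, hj']
  · simp

lemma norm_blockVec_le {χ : Fin p → ℝ} (hχ : ∀ i, |χ i| ≤ 1) (j : Fin dbar) :
    ‖blockVec χ j‖ ≤ √(p : ℝ) := by
  refine Real.le_sqrt_of_sq_le ?_
  rw [← real_inner_self_eq_norm_sq, inner_blockVec]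
  have : ∀ i, χ i * blockVec χ j (i, j) ≤ 1 := fun i => by
    have h1 : blockVec χ j (i, j) = χ i := by simp [blockVec]
    rw [h1, ← sq, ← sq_abs]
    exact pow_le_one₀ (abs_nonneg _) (hχ i)
  refine (Finset.sum_le_sum fun i _ => this i).trans ?_
  simp

lemma diffMat_mulE_blockVec {ρ : Type*} (c : ℝ) (e : ρ → Fin (p - 1)) (χ : Fin p → ℝ)
    (j : Fin dbar) (r : ρ) (j' : Fin dbar) :
    (diffMat p dbar c e).mulE (blockVec χ j) (r, j') =
      if j' = j then c * (χ (rightBlock (e r)) - χ (leftBlock (e r))) else 0 := by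
  rw [diffMat_mulE_apply]
  by_cases h : j' = j <;> simp [blockVec, h]

/-- Testing the stationarity of the Lagrangian with a block vector. -/
lemma abs_test_le {ρ ρ' : Type*} [Fintype ρ] [Fintype ρ'] {M : Matrix ρ (Fin p × Fin dbar) ℝ}
    {M' : Matrix ρ' (Fin p × Fin dbar) ℝ} {g : EuclideanSpace ℝ (Fin p × Fin dbar)}
    {z₁ : EuclideanSpace ℝ ρ} {z₂ : EuclideanSpace ℝ ρ'}
    (h : ‖g + M.transpose.mulE z₁ + M'.transpose.mulE z₂‖ ≤ ε) {χ : Fin p → ℝ}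
    (hχ : ∀ i, |χ i| ≤ 1) (j : Fin dbar) :
    |∑ i, χ i * g (i, j) + inner ℝ (M.mulE (blockVec χ j)) z₁ +
      inner ℝ (M'.mulE (blockVec χ j)) z₂| ≤ √(p : ℝ) * ε := by
  rw [← inner_transpose_mulE, ← inner_transpose_mulE, ← inner_blockVec, ← inner_add_right,
    ← inner_add_right]
  exact (abs_real_inner_le_norm _ _).trans
    (mul_le_mul (norm_blockVec_le hχ j) h (norm_nonneg _) (Real.sqrt_nonneg _))

/-- As `m₁ ≥ 2`, the row numbered 1 is not in `ℳ`, so `A` has an entry of modulus `m L_f`; evaluate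
`A` at the corresponding unit vector. -/
lemma le_specNorm_A (hLf : 0 < Lf) (h₁ : 2 ≤ m₁) (h₂ : 1 ≤ m₂) (hd : 0 < dbar) :
    (m m₁ m₂ : ℝ) * Lf ≤ (A Lf m₁ m₂ dbar).specNorm := by
  have hN : 2 * 1 ≤ m₁ * m₂ := Nat.mul_le_mul h₁ h₂
  have hm : 1 < m m₁ m₂ := by change 1 < 3 * m₁ * m₂; rw [mul_assoc]; omega
  have hk : (⟨0, by omega⟩ : Fin (m m₁ m₂ - 1)) ∈ (rowsM m₁ m₂)ᶜ := by
    simp only [rowsM, Finset.mem_compl, Finset.mem_filter, Finset.mem_univ, true_and,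
      Finset.mem_image, Finset.mem_Icc, not_exists, not_and]
    rintro l ⟨hl, -⟩ h
    have := Nat.mul_le_mul hl h₁
    omega
  set k : {k // k ∈ (rowsM m₁ m₂)ᶜ} := ⟨_, hk⟩
  set w : EuclideanSpace ℝ (Fin (m m₁ m₂) × Fin dbar) :=
    EuclideanSpace.single (leftBlock k.1, ⟨0, hd⟩) 1
  have h3 := (Matrix.toEuclideanLin (A Lf m₁ m₂ dbar)).toContinuousLinearMap.le_opNorm w
  have h4 : ‖w‖ = 1 := by simp [w]
  have h5 : (Matrix.toEuclideanLin (A Lf m₁ m₂ dbar)).toContinuousLinearMap w =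
      (A Lf m₁ m₂ dbar).mulE w := rfl
  have h6 : (A Lf m₁ m₂ dbar).mulE w (k, ⟨0, hd⟩) = -((m m₁ m₂ : ℝ) * Lf) := by
    rw [A_eq_diffMat, diffMat_mulE_apply]
    simp [w, (leftBlock_ne_rightBlock k.1).symm]
  have h7 := PiLp.norm_apply_le ((A Lf m₁ m₂ dbar).mulE w) (k, ⟨0, hd⟩)
  rw [h6, norm_neg, Real.norm_of_nonneg (by positivity)] at h7
  rw [h4, h5, mul_one] at h3
  exact h7.trans h3

lemma abs_grad_le (hδ : 0 < δ) (hLf : 0 < Lf) (hm : 0 < m m₁ m₂)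
    (x : EuclideanSpace ℝ (Fin (m m₁ m₂) × Fin dbar)) (q : Fin (m m₁ m₂) × Fin dbar) :
    |grad δ Lf m₁ m₂ x q| ≤ outerScale δ Lf m₁ m₂ * innerScale δ Lf m₁ m₂ * (25 * Real.pi) := by
  have hac := mul_pos (outerScale_pos hδ hLf hm) (innerScale_pos hδ hLf hm)
  change |-(outerScale δ Lf m₁ m₂ * innerScale δ Lf m₁ m₂ * slope δ Lf m₁ m₂ x q.1 q.2)| ≤ _
  rw [abs_neg, abs_of_nonneg (mul_nonneg hac.le (slope_nonneg _ _ _))]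
  exact mul_le_mul_of_nonneg_left (slope_le _ _ _) hac.le

lemma abs_multiplier_le (hδ : 0 < δ) (hLf : 0 < Lf) (hm : 0 < m m₁ m₂)
    {x : EuclideanSpace ℝ (Fin (m m₁ m₂) × Fin dbar)}
    {z₁ : EuclideanSpace ℝ ({k // k ∈ rowsM m₁ m₂} × Fin dbar)}
    {z₂ : EuclideanSpace ℝ ({k // k ∈ (rowsM m₁ m₂)ᶜ} × Fin dbar)}
    (h : ‖grad δ Lf m₁ m₂ x + (Abar Lf m₁ m₂ dbar).transpose.mulE z₁ +
      (A Lf m₁ m₂ dbar).transpose.mulE z₂‖ ≤ ε) (q : {k // k ∈ rowsM m₁ m₂} × Fin dbar) :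
    (m m₁ m₂ : ℝ) * Lf * |z₁ q| ≤
      √(m m₁ m₂ : ℝ) * ε + 50 * Real.pi * √(m m₁ m₂ : ℝ) * δ := by
  obtain ⟨k, j⟩ := q
  have h0 : (0 : ℝ) < (m m₁ m₂ : ℕ) := Nat.cast_pos.2 hm
  -- A step function that jumps only across the row `k` of `ℳ`: `A` annihilates the block vector,
  -- and `Ā` isolates the single multiplier `z₁ (k, j)`.
  set χ : Fin (m m₁ m₂) → ℝ := fun i => if (i : ℕ) ≤ k.1 then 1 else 0 with hχ
  have hχ1 : ∀ i, |χ i| ≤ 1 := fun i => by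
    simp only [hχ]; split_ifs <;> simp
  have hdiff : ∀ l : Fin (m m₁ m₂ - 1),
      χ (rightBlock l) - χ (leftBlock l) = if l = k.1 then -1 else 0 := fun l => by
    simp only [hχ, rightBlock, leftBlock, Fin.ext_iff]
    split_ifs <;> first | omega | norm_num
  have key := abs_test_le h hχ1 j
  have e1 : inner ℝ ((A Lf m₁ m₂ dbar).mulE (blockVec χ j)) z₂ = 0 := by
    rw [PiLp.inner_apply]
    refine Finset.sum_eq_zero fun q _ => ?_
    have hne : q.1.1 ≠ k.1 := fun he => by
      have := Finset.mem_compl.1 q.1.2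
      rw [he] at this
      exact this k.2
    rw [A_eq_diffMat, show q = (q.1, q.2) from rfl, diffMat_mulE_blockVec, hdiff, if_neg hne]
    simp
  have e2 : inner ℝ ((Abar Lf m₁ m₂ dbar).mulE (blockVec χ j)) z₁ =
      -((m m₁ m₂ : ℝ) * Lf * z₁ (k, j)) := by
    rw [PiLp.inner_apply, Finset.sum_eq_single (k, j)]
    · rw [Abar_eq_diffMat, diffMat_mulE_blockVec, hdiff, if_pos rfl, if_pos rfl]
      simp [mul_comm]
    · rintro ⟨k', j'⟩ - hne
      rw [Abar_eq_diffMat, diffMat_mulE_blockVec, hdiff]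
      by_cases hj : j' = j
      · have hk : k'.1 ≠ k.1 := fun hk => hne (by rw [hj, Subtype.ext hk])
        simp [hk]
      · simp [hj]
    · simp
  rw [e1, e2, add_zero] at key
  have hsum : |∑ i, χ i * grad δ Lf m₁ m₂ x (i, j)| ≤ 50 * Real.pi * √(m m₁ m₂ : ℝ) * δ := by
    refine (Finset.abs_sum_le_sum_abs _ _).trans ?_
    have hb : ∀ i, |χ i * grad δ Lf m₁ m₂ x (i, j)| ≤
        outerScale δ Lf m₁ m₂ * innerScale δ Lf m₁ m₂ * (25 * Real.pi) := fun i => by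
      rw [abs_mul]
      have := mul_le_mul (hχ1 i) (abs_grad_le hδ hLf hm x (i, j)) (abs_nonneg _) zero_le_one
      rwa [one_mul] at this
    refine (Finset.sum_le_sum fun i _ => hb i).trans (le_of_eq ?_)
    rw [Finset.sum_const, Finset.card_univ, Fintype.card_fin, nsmul_eq_mul]
    have hs := Real.mul_self_sqrt h0.le
    have hac := outerScale_mul_innerScale hδ hLf hm
    calc _ = outerScale δ Lf m₁ m₂ * innerScale δ Lf m₁ m₂ * (25 * Real.pi) *
          (√(m m₁ m₂ : ℝ) * √(m m₁ m₂ : ℝ)) := by rw [hs]; ring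
      _ = (outerScale δ Lf m₁ m₂ * innerScale δ Lf m₁ m₂ * √(m m₁ m₂ : ℝ)) *
          (25 * Real.pi * √(m m₁ m₂ : ℝ)) := by ring
      _ = _ := by rw [hac]; ring
  have hz : (m m₁ m₂ : ℝ) * Lf * |z₁ (k, j)| = |(m m₁ m₂ : ℝ) * Lf * z₁ (k, j)| := by
    rw [abs_mul, abs_of_pos (mul_pos h0 hLf)]
  rw [hz]
  rw [abs_le] at key hsum
  rw [abs_le]
  constructor <;> linarith [key.1, key.2, hsum.1, hsum.2]

/-- An exact-penalty argument: a nonzero entry of `y` forces a subgradient entry of size `β / (m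
L_f)`, hence a multiplier within `ε` of that size, while `abs_multiplier_le` caps it. This would
give `β ≤ m L_f ε + √m ε + 50π √m δ`, and `m L_f ≤ ‖A‖` contradicts the choice of `β`. -/
lemma eq_zero_of_isStationary (hε : 0 < ε) (hδε : ε ≤ δ) (hLf : 0 < Lf)
    (hP : Params δ Lf β m₁ m₂ dbar)
    {x : EuclideanSpace ℝ (Fin (m m₁ m₂) × Fin dbar)}
    {y z₁ : EuclideanSpace ℝ ({k // k ∈ rowsM m₁ m₂} × Fin dbar)}
    {z₂ : EuclideanSpace ℝ ({k // k ∈ (rowsM m₁ m₂)ᶜ} × Fin dbar)}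
    (hdist : Metric.infEDist 0 ((fun v => v - z₁) '' convexSubdiff (gbar Lf β m₁ m₂ dbar) y) ≤
      ENNReal.ofReal ε)
    (h : ‖grad δ Lf m₁ m₂ x + (Abar Lf m₁ m₂ dbar).transpose.mulE z₁ +
      (A Lf m₁ m₂ dbar).transpose.mulE z₂‖ ≤ ε) : y = 0 := by
  obtain ⟨h₁, h₂, -, hd, -, hβ⟩ := hP
  have hN : 2 * 1 ≤ m₁ * m₂ := Nat.mul_le_mul h₁ h₂
  have hm : 1 ≤ m m₁ m₂ := by change 1 ≤ 3 * m₁ * m₂; rw [mul_assoc]; omega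
  have hm1 : (1 : ℝ) ≤ (m m₁ m₂ : ℕ) := Nat.one_le_cast.2 hm
  have hδ : 0 < δ := hε.trans_le hδε
  have hmL : 0 < (m m₁ m₂ : ℝ) * Lf := by positivity
  ext q
  by_contra hq
  have hq' : y q ≠ 0 := hq
  have hz := abs_multiplier_le hδ hLf hm h q
  have hs1 : 1 ≤ √(m m₁ m₂ : ℝ) := Real.one_le_sqrt.2 hm1
  have hlow : β / ((m m₁ m₂ : ℝ) * Lf) - ε ≤ |z₁ q| := by
    -- The slack `η` avoids having to show that the distance to the subdifferential is attained. An
    -- empty subdifferential is excluded, its distance being infinite.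
    refine le_of_forall_pos_le_add fun η hη => ?_
    have hlt : Metric.infEDist 0 ((fun v => v - z₁) '' convexSubdiff (gbar Lf β m₁ m₂ dbar) y) <
        ENNReal.ofReal (ε + η) :=
      hdist.trans_lt ((ENNReal.ofReal_lt_ofReal_iff (by positivity)).2 (by linarith))
    obtain ⟨_, ⟨v, hv, rfl⟩, hlt'⟩ := Metric.infEDist_lt_iff.1 hlt
    have hn : ‖v - z₁‖ < ε + η := by
      rw [edist_dist, ENNReal.ofReal_lt_ofReal_iff (by positivity), dist_zero_left] at hlt'
      exact hlt'
    have h3 := le_abs_of_mem_convexSubdiff y v hv hq'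
    have h4 : |v q - z₁ q| ≤ ‖v - z₁‖ := PiLp.norm_apply_le (v - z₁) q
    have h5 := abs_sub_abs_le_abs_sub (v q) (z₁ q)
    linarith
  have h6 := mul_le_mul_of_nonneg_left hlow hmL.le
  rw [mul_sub, mul_div_cancel₀ _ hmL.ne'] at h6
  have h7 := le_specNorm_A (dbar := dbar) hLf h₁ h₂ (by omega)
  have h8 : (m m₁ m₂ : ℝ) * Lf * ε ≤ (A Lf m₁ m₂ dbar).specNorm * √(m m₁ m₂ : ℝ) * δ := by
    have a1 : (m m₁ m₂ : ℝ) * Lf * 1 ≤ (A Lf m₁ m₂ dbar).specNorm * √(m m₁ m₂ : ℝ) :=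
      mul_le_mul h7 hs1 zero_le_one (hmL.le.trans h7)
    rw [mul_one] at a1
    exact mul_le_mul a1 hδε hε.le (hmL.le.trans a1)
  have h9 : √(m m₁ m₂ : ℝ) * ε ≤ √(m m₁ m₂ : ℝ) * δ := by gcongr
  nlinarith

/-- The two residuals together control the energy of the jumps between blocks, `(m L_f)² S ≤ 2ε²`,
and Cauchy–Schwarz costs a factor `m`. After scaling the squared deviation is at most `2 / (150π)²`.
-/
lemma abs_scaled_sub_le (hε : 0 < ε) (hδε : ε ≤ δ) (hm : 0 < m m₁ m₂)
    {x : EuclideanSpace ℝ (Fin (m m₁ m₂) × Fin dbar)}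
    (h₁ : ‖(Abar Lf m₁ m₂ dbar).mulE x‖ ≤ ε) (h₂ : ‖(A Lf m₁ m₂ dbar).mulE x‖ ≤ ε)
    (i : Fin (m m₁ m₂)) (k : ℕ) :
    |scaled δ Lf m₁ m₂ x i k - scaled δ Lf m₁ m₂ x ⟨0, hm⟩ k| ≤ 1 / 10 := by
  rcases Nat.eq_zero_or_pos k with rfl | hk
  · simp [scaled_zero]
  by_cases hkd : dbar < k
  · simp [scaled_of_lt _ _ _ _ _ _ hkd]
  obtain ⟨j, rfl⟩ : ∃ j : Fin dbar, k = (j : ℕ) + 1 := ⟨⟨k - 1, by omega⟩, by simp; omega⟩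
  have h0 : (0 : ℝ) < (m m₁ m₂ : ℕ) := Nat.cast_pos.2 hm
  have hδ : 0 < δ := hε.trans_le hδε
  rw [scaled_succ, scaled_succ]
  have hsum : ((m m₁ m₂ : ℝ) * Lf) ^ 2 *
      ∑ l : Fin (m m₁ m₂ - 1), (x (rightBlock l, j) - x (leftBlock l, j)) ^ 2 ≤ 2 * ε ^ 2 := by
    have a1 : ‖(Abar Lf m₁ m₂ dbar).mulE x‖ ^ 2 + ‖(A Lf m₁ m₂ dbar).mulE x‖ ^ 2 =
        ∑ q : Fin (m m₁ m₂ - 1) × Fin dbar,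
          ((m m₁ m₂ : ℝ) * Lf * (x (rightBlock q.1, q.2) - x (leftBlock q.1, q.2))) ^ 2 := by
      rw [EuclideanSpace.real_norm_sq_eq, EuclideanSpace.real_norm_sq_eq,
        ← sum_rows_eq (rowsM m₁ m₂) fun q : Fin (m m₁ m₂ - 1) × Fin dbar =>
          ((m m₁ m₂ : ℝ) * Lf * (x (rightBlock q.1, q.2) - x (leftBlock q.1, q.2))) ^ 2]
      congr 1
      · refine Finset.sum_congr rfl fun q _ => ?_
        rw [Abar_eq_diffMat, show q = (q.1, q.2) from rfl, diffMat_mulE_apply]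
      · refine Finset.sum_congr rfl fun q _ => ?_
        rw [A_eq_diffMat, show q = (q.1, q.2) from rfl, diffMat_mulE_apply]
    have a2 := pow_le_pow_left₀ (norm_nonneg _) h₁ 2
    have a3 := pow_le_pow_left₀ (norm_nonneg _) h₂ 2
    rw [Fintype.sum_prod_type, Finset.sum_comm] at a1
    have a4 := Finset.single_le_sum (s := Finset.univ) (f := fun j' : Fin dbar =>
      ∑ l : Fin (m m₁ m₂ - 1),
        ((m m₁ m₂ : ℝ) * Lf * (x (rightBlock l, j') - x (leftBlock l, j'))) ^ 2)
      (fun j' _ => Finset.sum_nonneg fun l _ => sq_nonneg _) (Finset.mem_univ j)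
    simp only [mul_pow, ← Finset.mul_sum] at a1 a4 ⊢
    linarith
  set W : ℕ → ℝ := fun n => if hn : n < m m₁ m₂ then x (⟨n, hn⟩, j) else 0 with hW
  have hWi : W i = x (i, j) := by simp [hW]
  have hW0 : W 0 = x (⟨0, hm⟩, j) := dif_pos hm
  have hdiff := sq_sub_le_mul_sum_sq_sub W (k := i) (n := m m₁ m₂ - 1) (by have := i.2; omega)
  rw [hWi, hW0, ← Fin.sum_univ_eq_sum_range (fun l => (W (l + 1) - W l) ^ 2)] at hdiff
  have hWl : ∀ l : Fin (m m₁ m₂ - 1), (W ((l : ℕ) + 1) - W l) ^ 2 =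
      (x (rightBlock l, j) - x (leftBlock l, j)) ^ 2 := fun l => by
    have := l.2
    simp only [hW]
    rw [dif_pos (by omega), dif_pos (by omega)]
    rfl
  simp_rw [hWl] at hdiff
  set S := ∑ l : Fin (m m₁ m₂ - 1), (x (rightBlock l, j) - x (leftBlock l, j)) ^ 2
  have hS : 0 ≤ S := Finset.sum_nonneg fun l _ => sq_nonneg _
  have hdiff' : (x (i, j) - x (⟨0, hm⟩, j)) ^ 2 ≤ (m m₁ m₂ : ℕ) * S :=
    hdiff.trans (mul_le_mul_of_nonneg_right (Nat.cast_le.2 (Nat.sub_le _ _)) hS)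
  refine abs_le_of_sq_le_sq ?_ (by norm_num)
  rw [← mul_sub, mul_pow]
  have hc2 : innerScale δ Lf m₁ m₂ ^ 2 = (m m₁ m₂ : ℝ) * Lf ^ 2 / (150 * Real.pi * δ) ^ 2 := by
    unfold innerScale
    rw [div_pow, mul_pow, Real.sq_sqrt h0.le]
  calc _ ≤ innerScale δ Lf m₁ m₂ ^ 2 * ((m m₁ m₂ : ℕ) * S) :=
        mul_le_mul_of_nonneg_left hdiff' (sq_nonneg _)
    _ = ((m m₁ m₂ : ℝ) * Lf) ^ 2 * S / (150 * Real.pi * δ) ^ 2 := by rw [hc2]; ring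
    _ ≤ 2 * δ ^ 2 / (150 * Real.pi * δ) ^ 2 := by
        have hεδ : 2 * ε ^ 2 ≤ 2 * δ ^ 2 := by gcongr
        exact div_le_div_of_nonneg_right (hsum.trans hεδ) (sq_nonneg _)
    _ = 2 / (150 * Real.pi) ^ 2 := by field_simp
    _ ≤ _ := by
        rw [div_le_iff₀ (by positivity)]
        nlinarith [Real.pi_gt_three]

/-- The weight `3` compensates for a link being present in only one third of the blocks; the initial
link has weight `1` in all of them. -/
lemma le_sum_weight {l : ℕ} (hl : l < dbar) :
    ((m m₁ m₂ : ℕ) : ℝ) ≤ ∑ i : Fin (m m₁ m₂), weight m₁ m₂ dbar ((i : ℕ) + 1) l := by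
  rw [Fin.sum_univ_eq_sum_range (fun i => weight m₁ m₂ dbar (i + 1) l)]
  have hm : m m₁ m₂ = 3 * (m₁ * m₂) := mul_assoc _ _ _
  rw [hm]
  generalize hN : m₁ * m₂ = N
  have hld : ¬ dbar ≤ l := by omega
  rcases Nat.eq_zero_or_pos l with rfl | hl0
  · simp [weight, hld]
  have aux : ∀ s ⊆ Finset.range (3 * N), s.card = N →
      (∀ i ∈ s, weight m₁ m₂ dbar (i + 1) l = 3) →
      ((3 * N : ℕ) : ℝ) ≤ ∑ i ∈ Finset.range (3 * N), weight m₁ m₂ dbar (i + 1) l := by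
    intro s hs hcard hw
    refine le_trans (le_of_eq ?_)
      (Finset.sum_le_sum_of_subset_of_nonneg hs fun i _ _ => weight_nonneg _ _ _ _ _)
    rw [Finset.sum_congr rfl hw, Finset.sum_const, hcard, nsmul_eq_mul]
    push_cast; ring
  rcases Nat.even_or_odd l with he | ho
  · refine aux (Finset.Ico (2 * N) (3 * N)) (fun i hi => ?_) (by simp; omega) fun i hi => ?_
    · have := Finset.mem_Ico.1 hi
      exact Finset.mem_range.2 this.2
    · have := Finset.mem_Ico.1 hi
      unfold weight
      rw [if_neg hld, if_neg hl0.ne', if_pos (Or.inr ⟨by omega, he⟩)]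
  · refine aux (Finset.range N) (fun i hi => ?_) (by simp) fun i hi => ?_
    · have := Finset.mem_range.1 hi
      exact Finset.mem_range.2 (by omega)
    · have := Finset.mem_range.1 hi
      unfold weight
      rw [if_neg hld, if_neg hl0.ne', if_pos (Or.inl ⟨by omega, ho⟩)]

/-- At a stationary point no coordinate of the first block vanishes. -/
lemma ne_zero_of_isStationary (hε : 0 < ε) (hδε : ε ≤ δ) (hLf : 0 < Lf)
    (hP : Params δ Lf β m₁ m₂ dbar) (hm : 0 < m m₁ m₂)
    {x : EuclideanSpace ℝ (Fin (m m₁ m₂) × Fin dbar)}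
    {y : EuclideanSpace ℝ ({k // k ∈ rowsM m₁ m₂} × Fin dbar)}
    (h : (problem δ Lf β m₁ m₂ dbar).IsStationary ε x y) (j : Fin dbar) :
    x (⟨0, hm⟩, j) ≠ 0 := by
  intro hx
  obtain ⟨z₁, z₂, hdist, hgrad, hy, hA⟩ := h
  have hd : Odd dbar := hP.2.2.2.2.1
  have hδ : 0 < δ := hε.trans_le hδε
  have h0 : (0 : ℝ) < (m m₁ m₂ : ℕ) := Nat.cast_pos.2 hm
  replace hgrad : ‖grad δ Lf m₁ m₂ x + (Abar Lf m₁ m₂ dbar).transpose.mulE z₁ +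
      (A Lf m₁ m₂ dbar).transpose.mulE z₂‖ ≤ ε := by
    rw [← (hasGradientAt_f₀ δ Lf m₁ m₂ hd x).gradient]; exact hgrad
  have hy0 : y = 0 := eq_zero_of_isStationary hε hδε hLf hP hdist hgrad
  replace hA : ‖(A Lf m₁ m₂ dbar).mulE x‖ ≤ ε := by
    change ‖(A Lf m₁ m₂ dbar).mulE x + 0‖ ≤ ε at hA
    rwa [add_zero] at hA
  replace hy : ‖(Abar Lf m₁ m₂ dbar).mulE x‖ ≤ ε := by
    change ‖y - (Abar Lf m₁ m₂ dbar).mulE x - 0‖ ≤ ε at hy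
    rwa [hy0, sub_zero, zero_sub, norm_neg] at hy
  have hclose := abs_scaled_sub_le hε hδε hm hy hA
  -- The first index where the chain drops below `1` is positive, since entry `0` is `1`. The link
  -- ending there has a large first argument and a moderate second one.
  have hex : ∃ k, |scaled δ Lf m₁ m₂ x ⟨0, hm⟩ k| < 1 :=
    ⟨(j : ℕ) + 1, by rw [scaled_succ, hx]; simp⟩
  classical
  obtain ⟨l, hl⟩ : ∃ l, Nat.find hex = l + 1 := by
    refine Nat.exists_eq_add_one_of_ne_zero fun h => ?_
    have := Nat.find_spec hex
    rw [h, scaled_zero] at this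
    simp at this
  have hspec : |scaled δ Lf m₁ m₂ x ⟨0, hm⟩ (l + 1)| < 1 := hl ▸ Nat.find_spec hex
  have hmin : 1 ≤ |scaled δ Lf m₁ m₂ x ⟨0, hm⟩ l| :=
    not_lt.1 (Nat.find_min hex (by omega))
  have hld : l < dbar := by
    have := Nat.find_min' hex (m := (j : ℕ) + 1) (by rw [scaled_succ, hx]; simp)
    have := j.2
    omega
  have hslope : ∀ i : Fin (m m₁ m₂),
      weight m₁ m₂ dbar ((i : ℕ) + 1) l * (3 / 4) ≤ slope δ Lf m₁ m₂ x i l := by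
    intro i
    have b1 := abs_sub_abs_le_abs_sub (scaled δ Lf m₁ m₂ x ⟨0, hm⟩ l) (scaled δ Lf m₁ m₂ x i l)
    have b2 := abs_sub_abs_le_abs_sub (scaled δ Lf m₁ m₂ x i (l + 1))
      (scaled δ Lf m₁ m₂ x ⟨0, hm⟩ (l + 1))
    have b3 := hclose i l
    have b4 := hclose i (l + 1)
    rw [abs_sub_comm] at b3
    have b5 : 3 / 4 ≤ linkSnd (scaled δ Lf m₁ m₂ x i l) (scaled δ Lf m₁ m₂ x i (l + 1)) :=
      linkSnd_ge (by linarith) (by linarith)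
    exact le_add_of_le_of_nonneg (mul_le_mul_of_nonneg_left b5 (weight_nonneg _ _ _ _ _))
      (mul_nonneg (weight_nonneg _ _ _ _ _) (linkFst_nonneg _ _))
  have hsum : (m m₁ m₂ : ℕ) * (3 / 4 : ℝ) ≤ ∑ i, slope δ Lf m₁ m₂ x i l := by
    refine le_trans ?_ (Finset.sum_le_sum fun i _ => hslope i)
    rw [← Finset.sum_mul]
    exact mul_le_mul_of_nonneg_right (le_sum_weight hld) (by norm_num)
  -- A vector constant across the blocks lies in the kernels of `A` and `Ā`, so the multipliers drop
  -- out of the test.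
  have htest := abs_test_le hgrad (χ := fun _ => 1) (by simp) ⟨l, hld⟩
  have e1 : (A Lf m₁ m₂ dbar).mulE (blockVec (fun _ => 1) ⟨l, hld⟩) = 0 := by
    ext ⟨r, j'⟩
    rw [A_eq_diffMat, diffMat_mulE_blockVec]
    simp
  have e2 : (Abar Lf m₁ m₂ dbar).mulE (blockVec (fun _ => 1) ⟨l, hld⟩) = 0 := by
    ext ⟨r, j'⟩
    rw [Abar_eq_diffMat, diffMat_mulE_blockVec]
    simp
  have e3 : ∑ i : Fin (m m₁ m₂), (1 : ℝ) * grad δ Lf m₁ m₂ x (i, ⟨l, hld⟩) =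
      -(outerScale δ Lf m₁ m₂ * innerScale δ Lf m₁ m₂ * ∑ i, slope δ Lf m₁ m₂ x i l) := by
    rw [Finset.mul_sum, ← Finset.sum_neg_distrib]
    simp [grad]
  rw [e1, e2, inner_zero_left, inner_zero_left, add_zero, add_zero, e3, abs_neg] at htest
  have hac := outerScale_mul_innerScale hδ hLf hm
  have hs := Real.mul_self_sqrt h0.le
  have c1 := mul_le_mul_of_nonneg_left ((le_abs_self _).trans htest)
    (Real.sqrt_nonneg ((m m₁ m₂ : ℕ) : ℝ))
  have c2 : √(m m₁ m₂ : ℝ) * (outerScale δ Lf m₁ m₂ * innerScale δ Lf m₁ m₂ *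
      ∑ i, slope δ Lf m₁ m₂ x i l) = 2 * δ * ∑ i, slope δ Lf m₁ m₂ x i l := by
    rw [← hac]; ring
  rw [c2, ← mul_assoc, hs] at c1
  have c3 := mul_le_mul_of_nonneg_left hsum (by positivity : 0 ≤ 2 * δ)
  have c4 := mul_le_mul_of_nonneg_left hδε h0.le
  -- The contradiction is `(3/2) m δ ≤ 2δ ∑ slope ≤ m ε ≤ m δ`.
  nlinarith [mul_pos h0 hδ]

end HardInstance

/-- For every `ε, L_f > 0` and every admissible choice of the parameters, the splitting
reformulation of the hard instance `𝒫` (with accuracy parameter `δ ∈ [ε, 2 ε]`, in particular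
`δ = ε`) satisfies the standing assumptions, and every sequence that starts at the origin and obeys
the linear-span assumption needs at least `⌈κ([Ā; A]) L_f Δ_F / (72000 π²) · ε⁻²⌉` oracle calls
before it reaches an `ε`-stationary point. -/
theorem mainTheorem2 (ε Lf : ℝ) (hε : 0 < ε) (hLf : 0 < Lf)
    (δ : ℝ) (hδ₁ : ε ≤ δ) (hδ₂ : δ ≤ 2 * ε)
    (m₁ m₂ dbar : ℕ) (β : ℝ) (hP : HardInstance.Params δ Lf β m₁ m₂ dbar) :
    (HardInstance.problem δ Lf β m₁ m₂ dbar).Admissible Lf ∧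
    ∀ x y, x 0 = 0 → y 0 = 0 →
      (HardInstance.problem δ Lf β m₁ m₂ dbar).LinearSpan x y →
      ∀ t : ℕ, (HardInstance.problem δ Lf β m₁ m₂ dbar).IsStationary ε (x t) (y t) →
        ⌈(HardInstance.problem δ Lf β m₁ m₂ dbar).jointCond * Lf *
            (HardInstance.problem δ Lf β m₁ m₂ dbar).gap (x 0) (y 0) /
            (72000 * Real.pi ^ 2) * (ε ^ 2)⁻¹⌉₊ ≤ t := by
  have hP' := hP
  obtain ⟨h₁, h₂, -, hd5, hd, hβ⟩ := hP'
  have hδ : 0 < δ := hε.trans_le hδ₁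
  have hN : 2 * 1 ≤ m₁ * m₂ := Nat.mul_le_mul h₁ h₂
  have hmN : HardInstance.m m₁ m₂ = 3 * (m₁ * m₂) := mul_assoc _ _ _
  have hm : 0 < HardInstance.m m₁ m₂ := by omega
  have hβ0 : 0 ≤ β := by
    refine le_trans ?_ hβ.le
    have : 0 ≤ (HardInstance.A Lf m₁ m₂ dbar).specNorm := norm_nonneg _
    positivity
  refine ⟨HardInstance.admissible_problem hδ hLf hm hd hβ0, ?_⟩
  intro x y hx0 hy0 hspan t hstat
  have hne := HardInstance.ne_zero_of_isStationary hε hδ₁ hLf hP hm hstat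
    ⟨dbar - 1, by omega⟩
  have hmem := (HardInstance.linearSpan_mem hLf hβ0 hd hx0 hy0 hspan t).1
  have hact : HardInstance.activation (m₁ * m₂) 0 (dbar - 1) ≤ t := by
    by_contra hlt
    exact hne (hmem (⟨0, hm⟩, ⟨dbar - 1, by omega⟩) (not_le.1 hlt))
  -- The last coordinate has even index counted from `0`: it is switched on in the last third and
  -- must travel back to the first block, so its activation time there is `(dbar - 2) N + N`.
  have hodd : ¬ Odd (dbar - 1) := by
    obtain ⟨q, rfl⟩ := hd
    rw [Nat.not_odd_iff_even]
    exact ⟨q, by omega⟩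
  have ht : ((dbar : ℤ) - 1) * (m₁ * m₂ : ℕ) ≤ t := by
    unfold HardInstance.activation HardInstance.middlePos at hact
    rw [if_neg hodd] at hact
    have e : min (max (((0 : ℕ) : ℤ) + 1 - (m₁ * m₂ : ℕ)) 0) (m₁ * m₂ : ℕ) = 0 := by omega
    rw [e, Nat.cast_sub (by omega)] at hact
    push_cast at hact ⊢
    linarith
  have htR : ((dbar : ℝ) - 1) * (m₁ * m₂ : ℕ) ≤ t := by exact_mod_cast ht
  have hgap := HardInstance.gap_problem_le (β := β) hδ hLf hm hd hβ0
  have hcond := HardInstance.jointCond_problem_le (dbar := dbar) (δ := δ) (β := β) hLf hm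
  have hcond0 : 0 ≤ (HardInstance.problem δ Lf β m₁ m₂ dbar).jointCond := Real.sqrt_nonneg _
  rw [hx0, hy0]
  refine Nat.ceil_le.2 (le_trans ?_ htR)
  set κ := (HardInstance.problem δ Lf β m₁ m₂ dbar).jointCond
  set G := (HardInstance.problem δ Lf β m₁ m₂ dbar).gap 0 0
  have hmR : ((HardInstance.m m₁ m₂ : ℕ) : ℝ) = 3 * (m₁ * m₂ : ℕ) := by rw [hmN]; push_cast; ring
  rw [hmR] at hcond
  generalize ((m₁ * m₂ : ℕ) : ℝ) = N at hcond ⊢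
  have hN0 : 0 ≤ N := by linarith
  have hπ := Real.pi_pos
  have hd5' : (5 : ℝ) ≤ dbar := by exact_mod_cast hd5
  calc κ * Lf * G / (72000 * Real.pi ^ 2) * (ε ^ 2)⁻¹
      ≤ κ * Lf * (1800 * Real.pi ^ 2 * (2 * ε) ^ 2 * dbar / Lf) / (72000 * Real.pi ^ 2) *
          (ε ^ 2)⁻¹ := by
        gcongr
        exact hgap.trans (by gcongr)
    _ = κ * dbar / 10 := by field_simp; ring
    _ ≤ 2 * (3 * N) * dbar / 10 := by gcongr
    -- `6/10 * dbar ≤ dbar - 1` as soon as `dbar ≥ 5/2`.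
    _ ≤ (dbar - 1) * N := by nlinarith
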